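/- \textbf{Definitions.} For a finite graph $G=(V,E)$ and $z\in\mathbb C^V$ let $Z_G(z)=\sum_{I}\prod_{v\in I}z_v$, the sum over all independent sets $I$ of $G$; for $p\in\mathbb C^V$ let $\breve q_V(p)=\sum_{I}(-1)^{|I|}\prod_{v\in I}p_v = Z_G(-p)$. The (complex) Shearer region is $$\mathcal S_G=\{p\in\mathbb C^V:\ Z_G(z)\neq 0\text{ for all }z\in\mathbb C^V\text{ with }|z_v|\le|p_v|\text{ for all }v\in V\}.$$ Let $N(v,i)$ be the number of self-avoiding walks of length $i$ in $G$ that start at $v$. A family $\mathcal G$ of finite graphs has \emph{connective constant at most $\Delta$, with constants $a,c>0$}, if for every $G\in\mathcal G$ with $n$ vertices, every vertex $v$ of $G$ and every integer $\ell\ge a\log n$, $$\sum_{i=0}^{\ell}N(v,i)\le c\,\Delta^{\ell}.$$ (No bound on the maximum degree is assumed.) The machine model is a random access machine with complex arithmetic: while-programs over finitely many arrays of natural numbers and of complex numbers, with indirect addressing, where each memory access, assignment, test (comparison of natural numbers) and arithmetic operation ($+,-$ on natural numbers; $+,-,\times,/$ on complex numbers) costs one unit of time. All numerical constants of a program are integers,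 and a division by zero is not allowed to occur. \textbf{Theorem.} There are one program and an absolute constant $K$ such that the following holds. Let $\mathcal G$ be a family of finite graphs of connective constant at most $\Delta$, with constants $a,c$. There is a constant $C$, depending only on $\mathcal G,\Delta,a,c$, such that for every graph $G=(V,E)\in\mathcal G$ with $n\ge1$ vertices, every $\alpha\in(0,1]$, every $0<\epsilon\le 1/n$ and every $p\in\mathbb C^V$ with $(1+\alpha)^2p\in\mathcal S_G$, with $$\ell=\max\Big\{a\log n,\ \frac{4}{\sqrt\alpha}\log\frac{n}{\epsilon\alpha}\Big\},$$ the program, given $G$ (by adjacency lists in arbitrary order), $p$ and the integer $\lceil\ell\rceil$ as input, halts after at most $C\,n\,\Delta^{\ell}$ time units and outputs a complex number $Q$ with $$|Q-\breve q_V(p)|\le K\,\epsilon n\,|\breve q_V(p)|.$$ -/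

import Mathlib

open Finset

/-! ## Independence polynomials and the complex Shearer region -/

open scoped Classical in
/-- The independence polynomial `Z_G(z) = ∑_{I independent} ∏_{v ∈ I} z_v`. -/
noncomputable def indepPoly {V : Type*} [Fintype V] (G : SimpleGraph V) (z : V → ℂ) : ℂ :=
  ∑ I ∈ (univ : Finset (Finset V)).filter (fun I : Finset V => G.IsIndepSet (I : Set V)),
    ∏ v ∈ I, z v

open scoped Classical in
/-- The alternating-sign independence polynomial
`q̆_S(p) = ∑_{I ⊆ S independent} (-1)^|I| ∏_{v ∈ I} p_v`. -/
noncomputable def altIndepPoly {V : Type*} (G : SimpleGraph V) (S : Finset V) (p : V → ℂ) : ℂ :=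
  ∑ I ∈ S.powerset.filter (fun I : Finset V => G.IsIndepSet (I : Set V)),
    (-1) ^ I.card * ∏ v ∈ I, p v

/-- The complex Shearer region: the vectors `p` such that `Z_G` has no zero in the closed polydisc
`|z_v| ≤ |p_v|`. -/
def shearerRegion {V : Type*} [Fintype V] (G : SimpleGraph V) : Set (V → ℂ) :=
  {p | ∀ z : V → ℂ, (∀ v, ‖z v‖ ≤ ‖p v‖) → indepPoly G z ≠ 0}

/-! ## Connective constant of a family of finite graphs -/

/-- The number `N(v, i)` of self-avoiding walks of length `i` in `G` starting at `v`. -/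
noncomputable def sawCount {V : Type*} (G : SimpleGraph V) (v : V) (i : ℕ) : ℕ :=
  {w : Σ u, G.Walk v u | w.2.IsPath ∧ w.2.length = i}.ncard

/-- Finite graphs, with vertices numbered `0, …, n - 1`. -/
abbrev FinGraph := Σ n : ℕ, SimpleGraph (Fin n)

/-- The family `𝒢` has connective constant at most `Δ`, with witnessing constants `a` and `c`: in
every graph of `𝒢` with `n` vertices, the number of self-avoiding walks of length at most `ℓ` from
any vertex is at most `c * Δ ^ ℓ` as soon as `ℓ ≥ a * log n`. -/
def ConnectiveConstantAtMost (𝒢 : Set FinGraph) (Δ a c : ℝ) : Prop :=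
  0 < a ∧ 0 < c ∧ ∀ (n : ℕ) (G : SimpleGraph (Fin n)), (⟨n, G⟩ : FinGraph) ∈ 𝒢 →
    ∀ (v : Fin n) (ℓ : ℕ), a * Real.log n ≤ ℓ →
      (∑ i ∈ range (ℓ + 1), (sawCount G v i : ℝ)) ≤ c * Δ ^ ℓ

/-! ## A random access machine with complex arithmetic

Programs are while-programs over finitely many named arrays, some holding natural numbers and some
holding complex numbers, with indirect addressing. Every memory access, arithmetic operation, test
and assignment costs one time unit. Complex numbers can only be copied, added, subtracted,
multiplied and divided; the only numerical constants in a program are integers; and a division by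
zero blocks the execution. -/

namespace RAM

/-- The memory: `nat a i` and `cplx a i` are the contents of cell `i` of array number `a`. -/
structure Memory where
  nat : ℕ → ℕ → ℕ
  cplx : ℕ → ℕ → ℂ

/-- Expressions with values in `ℕ`; `get a i` reads cell `i` of the array `a`. -/
inductive NExp where
  | lit (k : ℕ)
  | get (a : ℕ) (i : NExp)
  | add (e f : NExp)
  | sub (e f : NExp)

/-- Expressions with values in `ℂ`; `get a i` reads cell `i` of the array `a`. -/
inductive CExp where
  | lit (k : ℤ)
  | get (a : ℕ) (i : NExp)
  | add (x y : CExp)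
  | sub (x y : CExp)
  | mul (x y : CExp)
  | div (x y : CExp)

/-- Tests, on natural numbers only. -/
inductive Test where
  | lt (e f : NExp)
  | eq (e f : NExp)

inductive Cmd where
  | skip
  | setNat (a : ℕ) (i e : NExp)
  | setCplx (a : ℕ) (i : NExp) (x : CExp)
  | seq (P Q : Cmd)
  | ite (b : Test) (P Q : Cmd)
  | while (b : Test) (P : Cmd)

/-- Value of an expression; `sub` is truncated subtraction. -/
def NExp.eval (s : Memory) : NExp → ℕ
  | lit k => k
  | get a i => s.nat a (i.eval s)
  | add e f => e.eval s + f.eval s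
  | sub e f => e.eval s - f.eval s

/-- Number of elementary operations in the evaluation of an expression. -/
def NExp.cost : NExp → ℕ
  | lit _ => 1
  | get _ i => i.cost + 1
  | add e f => e.cost + f.cost + 1
  | sub e f => e.cost + f.cost + 1

noncomputable def CExp.eval (s : Memory) : CExp → ℂ
  | lit k => k
  | get a i => s.cplx a (i.eval s)
  | add x y => x.eval s + y.eval s
  | sub x y => x.eval s - y.eval s
  | mul x y => x.eval s * y.eval s
  | div x y => x.eval s / y.eval s

/-- No division by zero occurs in the evaluation of the expression. -/
def CExp.Defined (s : Memory) : CExp → Prop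
  | lit _ => True
  | get _ _ => True
  | add x y => x.Defined s ∧ y.Defined s
  | sub x y => x.Defined s ∧ y.Defined s
  | mul x y => x.Defined s ∧ y.Defined s
  | div x y => x.Defined s ∧ y.Defined s ∧ y.eval s ≠ 0

def CExp.cost : CExp → ℕ
  | lit _ => 1
  | get _ i => i.cost + 1
  | add x y => x.cost + y.cost + 1
  | sub x y => x.cost + y.cost + 1
  | mul x y => x.cost + y.cost + 1
  | div x y => x.cost + y.cost + 1

def Test.Holds (s : Memory) : Test → Prop
  | lt e f => e.eval s < f.eval s
  | eq e f => e.eval s = f.eval s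

def Test.cost : Test → ℕ
  | lt e f => e.cost + f.cost + 1
  | eq e f => e.cost + f.cost + 1

/-- The memory after writing `k` into cell `i` of the natural number array `a`. -/
def Memory.writeNat (s : Memory) (a i k : ℕ) : Memory :=
  { s with nat := Function.update s.nat a (Function.update (s.nat a) i k) }

/-- The memory after writing `x` into cell `i` of the complex array `a`. -/
def Memory.writeCplx (s : Memory) (a i : ℕ) (x : ℂ) : Memory :=
  { s with cplx := Function.update s.cplx a (Function.update (s.cplx a) i x) }

/-- `Exec P s t s₁`: started in memory `s`, the program `P` halts after exactly `t` time units
with memory `s₁`. -/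
inductive Exec : Cmd → Memory → ℕ → Memory → Prop
  | skip (s : Memory) : Exec .skip s 1 s
  | setNat (a : ℕ) (i e : NExp) (s : Memory) :
      Exec (.setNat a i e) s (i.cost + e.cost + 1) (s.writeNat a (i.eval s) (e.eval s))
  | setCplx (a : ℕ) (i : NExp) (x : CExp) (s : Memory) (h : x.Defined s) :
      Exec (.setCplx a i x) s (i.cost + x.cost + 1) (s.writeCplx a (i.eval s) (x.eval s))
  | seq {P Q : Cmd} {s s₁ s₂ : Memory} {t₁ t₂ : ℕ}
      (h₁ : Exec P s t₁ s₁) (h₂ : Exec Q s₁ t₂ s₂) : Exec (.seq P Q) s (t₁ + t₂) s₂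
  | iteTrue {b : Test} {P Q : Cmd} {s s₁ : Memory} {t : ℕ}
      (hb : b.Holds s) (h : Exec P s t s₁) : Exec (.ite b P Q) s (b.cost + t) s₁
  | iteFalse {b : Test} {P Q : Cmd} {s s₁ : Memory} {t : ℕ}
      (hb : ¬ b.Holds s) (h : Exec Q s t s₁) : Exec (.ite b P Q) s (b.cost + t) s₁
  | whileTrue {b : Test} {P : Cmd} {s s₁ s₂ : Memory} {t₁ t₂ : ℕ}
      (hb : b.Holds s) (h₁ : Exec P s t₁ s₁) (h₂ : Exec (.while b P) s₁ t₂ s₂) :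
      Exec (.while b P) s (b.cost + t₁ + t₂) s₂
  | whileFalse {b : Test} {P : Cmd} {s : Memory}
      (hb : ¬ b.Holds s) : Exec (.while b P) s b.cost s

end RAM

/-! ## Input and output -/

/-- `adj v` lists the neighbours of `v`, each once, in an arbitrary order. -/
def IsAdjLists {n : ℕ} (G : SimpleGraph (Fin n)) (adj : Fin n → List (Fin n)) : Prop :=
  ∀ v, (adj v).Nodup ∧ ∀ w, w ∈ adj v ↔ G.Adj v w

/-- The memory `s` presents the input consisting of a graph given by adjacency lists, complex vertex
parameters and a natural number `L`. The adjacency list of `v` has its length in cell `v` of array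
`1` and its starting address in cell `v` of array `2`, and is stored from there on in array `3`.
The work space is initially zero. -/
structure IsInput (n : ℕ) (adj : Fin n → List (Fin n)) (p : Fin n → ℂ) (L : ℕ)
    (s : RAM.Memory) : Prop where
  size : s.nat 0 0 = n
  depth : s.nat 0 1 = L
  degree : ∀ v : Fin n, s.nat 1 v = (adj v).length
  neighbour : ∀ (v : Fin n) (k : Fin (adj v).length),
    s.nat 3 (s.nat 2 v + k) = ((adj v).get k : ℕ)
  parameter : ∀ v : Fin n, s.cplx 0 v = p v
  natZero : ∀ b, 4 ≤ b → ∀ i, s.nat b i = 0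
  cplxZero : ∀ b, 1 ≤ b → ∀ i, s.cplx b i = 0

/-- The number that a program returns. -/
def output (s : RAM.Memory) : ℂ := s.cplx 1 0

/-! Write `q_S` for the alternating polynomial of the graph induced on `S`. Deleting the vertices
one after the other expresses `q_V` as a product of ratios `R = q_{S ∪ v} / q_S`. The identity `q_{S
∪ v} = q_S - p_v q_{S \ N(v)}` turns each ratio into `R = 1 - p_v / ∏ R_c`, where `c` runs over the
neighbours still present, deleted in the order of the adjacency list (`exactRatio_eq`). The program
evaluates this recursion truncated at depth `⌈ℓ⌉`, with the value `1` below.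

Accuracy. Let `r` and `r'` be the ratios at the nonnegative vectors `|p|` and `(1+α)²|p|`, where all
`q_S` are positive. Then `|1 - R| ≤ 1 - r`, for the exact and for the truncated ratios. The
truncation error is measured against the potential `r - r'`. With `x = 1 - r` and `x' = 1 - r'`, one
step of the recursion turns errors `A (r_c - r'_c)` of the children into at most `A x log (x' / (x
(1+α)²))`, and `mul_log_sub_le` bounds this by `A exp(-√α) (x' - x)`. So each level gains `exp(-√α)`
whatever the degrees (`norm_ratio_sub_exactRatio_le`), and `r - r' ≤ |R|` makes the error relative.

Time. The nodes of the recursion tree are distinct self-avoiding walks, but a node costs the degree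
of its endpoint, which is unbounded. A neighbour of the endpoint is off the walk, or is the
predecessor, or closes a chord. Neighbours off the walk are charged to the extended walk, chords to
the walk obtained by reversing the part cut off by the chord. Since deletions follow the adjacency
lists, a rotated walk comes from only one walk of the tree and one chord (`sum_card_chords_le`). The
total is therefore linear in the number of self-avoiding walks (`nodeSteps_le`).

The program is a depth-first traversal with an explicit stack. Removed vertices are stamped with the
stack height, so that each frame can undo its own removals; `exec_ratioProgram` bounds the time per
elementary step by a constant. -/

/-! ### Deletion of vertices and the recursion for the ratios -/

section DeletionRecursion

open scoped Classical in
/-- The alternating-sign independence polynomial over an arbitrary commutative ring. -/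
noncomputable def altPoly {R V : Type*} [CommRing R] (G : SimpleGraph V) (S : Finset V)
    (p : V → R) : R :=
  ∑ I ∈ S.powerset.filter (fun I : Finset V => G.IsIndepSet (I : Set V)),
    (-1) ^ I.card * ∏ v ∈ I, p v

theorem altIndepPoly_eq_altPoly {V : Type*} (G : SimpleGraph V) (S : Finset V) (p : V → ℂ) :
    altIndepPoly G S p = altPoly G S p := rfl

theorem altPoly_empty {R V : Type*} [CommRing R] (G : SimpleGraph V) (p : V → R) :
    altPoly G ∅ p = 1 := by
  classical
  have : G.IsIndepSet ((∅ : Finset V) : Set V) := by simp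
  simp [altPoly, Finset.filter_singleton]

theorem isIndepSet_insert_iff {V : Type*} [DecidableEq V] (G : SimpleGraph V) (v : V)
    (I : Finset V) (hv : v ∉ I) :
    G.IsIndepSet ((insert v I : Finset V) : Set V) ↔
      G.IsIndepSet (I : Set V) ∧ ∀ w ∈ I, ¬ G.Adj v w := by
  rw [SimpleGraph.IsIndepSet, Finset.coe_insert, Set.pairwise_insert_of_notMem (by simpa using hv)]
  simp only [SimpleGraph.IsIndepSet, Finset.mem_coe]
  constructor
  · exact fun h => ⟨h.1, fun w hw => (h.2 w hw).1⟩
  · exact fun h => ⟨h.1, fun w hw => ⟨h.2 w hw, fun h' => h.2 w hw h'.symm⟩⟩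

/-- The independent sets containing `v` are those of the non-neighbours of `v` in `S` with `v`
added; the extra vertex contributes the factor `-p v`. -/
theorem altPoly_insert {R V : Type*} [CommRing R] [DecidableEq V] (G : SimpleGraph V)
    [DecidableRel G.Adj] (S : Finset V) (p : V → R) (v : V) (hv : v ∉ S) :
    altPoly G (insert v S) p =
      altPoly G S p - p v * altPoly G (S.filter (fun w => ¬ G.Adj v w)) p := by
  classical
  have key : altPoly G (insert v S) p = altPoly G S p + ∑ I ∈ S.powerset.filter
      (fun I : Finset V => G.IsIndepSet ((insert v I : Finset V) : Set V)),
        (-1) ^ (insert v I).card * ∏ w ∈ insert v I, p w := by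
    simp only [altPoly, Finset.sum_filter]
    rw [Finset.sum_powerset_insert hv, add_right_inj]
    refine Finset.sum_congr rfl (fun I _ => ?_)
    by_cases h : G.IsIndepSet ((insert v I : Finset V) : Set V)
    · rw [if_pos h, if_pos h]
    · rw [if_neg h, if_neg h]
  rw [key, sub_eq_add_neg, add_right_inj]
  rw [altPoly, Finset.mul_sum, ← Finset.sum_neg_distrib]
  symm
  apply Finset.sum_congr_of_eq_on_inter
  · intro I hI hI'
    exfalso
    apply hI'
    simp only [Finset.mem_filter, Finset.mem_powerset] at hI ⊢
    have hIS : I ⊆ S := hI.1.trans (Finset.filter_subset _ _)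
    exact ⟨hIS, (isIndepSet_insert_iff G v I (fun h => hv (hIS h))).2
      ⟨hI.2, fun w hw => (Finset.mem_filter.1 (hI.1 hw)).2⟩⟩
  · intro I hI hI'
    exfalso
    apply hI'
    simp only [Finset.mem_filter, Finset.mem_powerset] at hI ⊢
    have h := (isIndepSet_insert_iff G v I (fun h => hv (hI.1 h))).1 hI.2
    exact ⟨fun w hw => Finset.mem_filter.2 ⟨hI.1 hw, h.2 w hw⟩, h.1⟩
  · intro I _ hI
    simp only [Finset.mem_filter, Finset.mem_powerset] at hI
    have hvI : v ∉ I := fun h => hv (hI.1 h)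
    rw [Finset.card_insert_of_notMem hvI, Finset.prod_insert hvI]
    ring

theorem ofReal_altPoly {V : Type*} (G : SimpleGraph V) (S : Finset V) (P : V → ℝ) :
    altPoly G S (fun v => (P v : ℂ)) = ((altPoly G S P : ℝ) : ℂ) := by
  simp [altPoly]

/-- Zeroing the coordinates outside `S` kills every set not contained in `S`. Such a point stays in
the same polydisc, so the Shearer condition passes to induced subgraphs. -/
theorem altPoly_eq_indepPoly {V : Type*} [Fintype V] [DecidableEq V] (G : SimpleGraph V)
    (S : Finset V) (p : V → ℂ) :
    altPoly G S p = indepPoly G (fun v => if v ∈ S then - p v else 0) := by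
  classical
  simp only [altPoly, indepPoly]
  refine Finset.sum_subset_zero_on_sdiff ?_ ?_ ?_
  · intro I hI
    simp only [Finset.mem_filter, Finset.mem_univ, true_and] at hI ⊢
    exact hI.2
  · intro I hI
    simp only [Finset.mem_sdiff, Finset.mem_filter, Finset.mem_univ, true_and,
      Finset.mem_powerset, not_and] at hI
    have : ¬ I ⊆ S := fun h => hI.2 h hI.1
    obtain ⟨w, hw, hwS⟩ := Finset.not_subset.1 this
    exact Finset.prod_eq_zero hw (by simp [hwS])
  · intro I hI
    simp only [Finset.mem_filter, Finset.mem_powerset] at hI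
    rw [← Finset.prod_neg]
    exact Finset.prod_congr rfl (fun v hv => (if_pos (hI.1 hv)).symm)

/-- In the Shearer region all alternating independence polynomials are positive at the vector of
absolute values. -/
theorem altPoly_pos_of_mem_shearerRegion {V : Type*} [Fintype V] (G : SimpleGraph V)
    (p : V → ℂ) (hp : p ∈ shearerRegion G) (S : Finset V) :
    0 < altPoly G S (fun v => ‖p v‖) := by
  classical
  -- Along the segment from `0`, where the value is `1`, to the vector of absolute values there is
  -- no zero, hence no change of sign.
  set f : ℝ → ℝ := fun t => altPoly G S (fun v => t * ‖p v‖) with hf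
  have hcont : Continuous f := by
    simp only [hf, altPoly]
    fun_prop
  have hne : ∀ t ∈ Set.Icc (0 : ℝ) 1, f t ≠ 0 := by
    intro t ht h0
    have h1 : altPoly G S (fun v => ((t * ‖p v‖ : ℝ) : ℂ)) = 0 := by
      rw [ofReal_altPoly]
      exact_mod_cast h0
    rw [altPoly_eq_indepPoly] at h1
    refine hp _ (fun v => ?_) h1
    split_ifs
    · rw [norm_neg, Complex.norm_real, Real.norm_eq_abs,
        abs_of_nonneg (mul_nonneg ht.1 (norm_nonneg _))]
      exact mul_le_of_le_one_left (norm_nonneg _) ht.2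
    · simp
  have h0 : f 0 = 1 := by
    simp only [hf, zero_mul, altPoly]
    rw [Finset.sum_eq_single ∅]
    · simp
    · intro I _ hI
      obtain ⟨w, hw⟩ := Finset.nonempty_iff_ne_empty.2 hI
      rw [Finset.prod_eq_zero hw rfl, mul_zero]
    · intro h
      simp at h
  have h1 : f 1 = altPoly G S (fun v => ‖p v‖) := by simp [hf]
  rw [← h1]
  by_contra hneg
  rw [not_lt] at hneg
  obtain ⟨t, ht, hft⟩ := intermediate_value_Icc' (zero_le_one' ℝ) hcont.continuousOn
    (show (0 : ℝ) ∈ Set.Icc (f 1) (f 0) from ⟨hneg, by rw [h0]; exact zero_le_one⟩)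
  exact hne t ht hft

variable {V : Type*} [DecidableEq V]

/-- Going through the list `ws` and removing its vertices one after the other from the graph: the
pairs consisting of a vertex that was still present and the set of vertices removed up to and
including it. -/
def kids : Finset V → List V → List (Finset V × V)
  | _, [] => []
  | M, w :: ws => if w ∈ M then kids M ws else (insert w M, w) :: kids (insert w M) ws

theorem snd_mem_fst_of_mem_kids {ws : List V} {M : Finset V} {c : Finset V × V}
    (hc : c ∈ kids M ws) : c.2 ∈ c.1 ∧ M ⊂ c.1 := by
  induction ws generalizing M with
  | nil => simp [kids] at hc
  | cons w ws ih =>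
    rw [kids] at hc
    split_ifs at hc with hw
    · exact ih hc
    · rcases List.mem_cons.1 hc with rfl | hc
      · exact ⟨Finset.mem_insert_self _ _, Finset.ssubset_insert hw⟩
      · exact ⟨(ih hc).1, (Finset.subset_insert _ _).trans_ssubset (ih hc).2⟩

variable [Fintype V]

/-- The ratio of alternating independence polynomials with and without the vertex `v`, when all
other vertices of `M` are removed. -/
noncomputable def exactRatio {K : Type*} [Field K] (G : SimpleGraph V) (p : V → K)
    (M : Finset V) (v : V) : K :=
  altPoly G (insert v Mᶜ) p / altPoly G Mᶜ p

/-- The product telescopes: each factor is the quotient of the polynomials before and after one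
deletion. -/
theorem prod_kids_exactRatio {K : Type*} [Field K] (G : SimpleGraph V) (p : V → K)
    (hq : ∀ S, altPoly G S p ≠ 0) (ws : List V) (M : Finset V) :
    ((kids M ws).map (fun c => exactRatio G p c.1 c.2)).prod =
      altPoly G Mᶜ p / altPoly G (Mᶜ.filter (fun w => w ∉ ws)) p := by
  induction ws generalizing M with
  | nil => simp [kids, hq]
  | cons w ws ih =>
    rw [kids]
    split_ifs with hw
    · rw [ih]
      congr 2
      ext x
      simp only [Finset.mem_filter, Finset.mem_compl, List.mem_cons, not_or]
      constructor
      · rintro ⟨h1, h2⟩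
        exact ⟨h1, fun h => h1 (h ▸ hw), h2⟩
      · rintro ⟨h1, -, h2⟩
        exact ⟨h1, h2⟩
    · rw [List.map_cons, List.prod_cons, ih, exactRatio]
      have e1 : insert w (insert w M)ᶜ = Mᶜ := by
        ext x
        simp only [Finset.mem_insert, Finset.mem_compl, not_or]
        constructor
        · rintro (rfl | h)
          · exact hw
          · exact h.2
        · intro h
          by_cases hx : x = w
          · exact Or.inl hx
          · exact Or.inr ⟨hx, h⟩
      have e2 : (insert w M)ᶜ.filter (fun x => x ∉ ws) = Mᶜ.filter (fun x => x ∉ w :: ws) := by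
        ext x
        simp only [Finset.mem_filter, Finset.mem_compl, List.mem_cons, Finset.mem_insert, not_or]
        tauto
      rw [e1, e2, div_mul_div_cancel₀ (hq _)]

/-- Divide the deletion identity by the polynomial of `Mᶜ`; the remaining quotient is the inverse of
the telescoping product over the neighbours of `v`. -/
theorem exactRatio_eq {K : Type*} [Field K] (G : SimpleGraph V) (p : V → K)
    (hq : ∀ S, altPoly G S p ≠ 0) (adj : V → List V) (hadj : ∀ v w, w ∈ adj v ↔ G.Adj v w)
    (M : Finset V) (v : V) (hv : v ∈ M) :
    exactRatio G p M v =
      1 - p v / ((kids M (adj v)).map (fun c => exactRatio G p c.1 c.2)).prod := by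
  classical
  rw [prod_kids_exactRatio G p hq, exactRatio, altPoly_insert G _ _ _ (by simpa using hv)]
  simp only [hadj]
  rw [sub_div, div_self (hq _), div_div_eq_mul_div]

end DeletionRecursion

/-! ### Domination by positive parameters and decay of the truncation error -/

section RatioBounds

theorem altPoly_ne_zero_of_mem_shearerRegion {V : Type*} [Fintype V] (G : SimpleGraph V)
    (p : V → ℂ) (hp : p ∈ shearerRegion G) (S : Finset V) : altPoly G S p ≠ 0 := by
  classical
  rw [altPoly_eq_indepPoly]
  refine hp _ (fun v => ?_)
  split_ifs
  · rw [norm_neg]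
  · simp

theorem shearerRegion_mono {V : Type*} [Fintype V] (G : SimpleGraph V) {p p' : V → ℂ}
    (hp : p' ∈ shearerRegion G) (h : ∀ v, ‖p v‖ ≤ ‖p' v‖) : p ∈ shearerRegion G :=
  fun z hz => hp z (fun v => (hz v).trans (h v))

theorem List.prod_pos_le_norm_prod {ι K : Type*} [NormedField K] (l : List ι) (f : ι → K)
    (r : ι → ℝ) (h : ∀ c ∈ l, 0 < r c ∧ r c ≤ ‖f c‖) :
    0 < (l.map r).prod ∧ (l.map r).prod ≤ ‖(l.map f).prod‖ := by
  induction l with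
  | nil => simp
  | cons c l ih =>
    have h1 := h c (by simp)
    have h2 := ih (fun d hd => h d (by simp [hd]))
    simp only [List.map_cons, List.prod_cons, norm_mul]
    exact ⟨mul_pos h1.1 h2.1, mul_le_mul h1.2 h2.2 h2.1.le (h1.1.le.trans h1.2)⟩

theorem List.norm_inv_prod_sub_inv_prod_le {ι K : Type*} [NormedField K] (l : List ι)
    (F R : ι → K) (r e : ι → ℝ)
    (h : ∀ c ∈ l, 0 < r c ∧ r c ≤ ‖F c‖ ∧ r c ≤ ‖R c‖ ∧ ‖F c - R c‖ ≤ e c) :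
    ‖((l.map F).prod)⁻¹ - ((l.map R).prod)⁻¹‖ ≤
      ((l.map r).prod)⁻¹ * (l.map (fun c => e c / r c)).sum := by
  induction l with
  | nil => simp
  | cons c l ih =>
    obtain ⟨hr, hF, hR, he⟩ := h c (by simp)
    have ih := ih (fun d hd => h d (by simp [hd]))
    have hA := List.prod_pos_le_norm_prod l F r (fun d hd =>
      ⟨(h d (by simp [hd])).1, (h d (by simp [hd])).2.1⟩)
    simp only [List.map_cons, List.prod_cons, List.sum_cons]
    set A := (l.map F).prod
    set B := (l.map R).prod
    set ρ := (l.map r).prod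
    set s := (l.map (fun c => e c / r c)).sum
    have hF0 : F c ≠ 0 := norm_pos_iff.1 (hr.trans_le hF)
    have hR0 : R c ≠ 0 := norm_pos_iff.1 (hr.trans_le hR)
    -- One factor is exchanged at a time, so the error of each factor enters relative to its lower
    -- bound.
    have key : (F c * A)⁻¹ - (R c * B)⁻¹ =
        (R c - F c) * (F c)⁻¹ * (R c)⁻¹ * A⁻¹ + (R c)⁻¹ * (A⁻¹ - B⁻¹) := by
      rw [mul_inv, mul_inv]
      have : (R c - F c) * (F c)⁻¹ * (R c)⁻¹ = (F c)⁻¹ - (R c)⁻¹ := by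
        field_simp
      rw [this]
      ring
    have hFi : ‖F c‖⁻¹ ≤ (r c)⁻¹ := inv_anti₀ hr hF
    have hRi : ‖R c‖⁻¹ ≤ (r c)⁻¹ := inv_anti₀ hr hR
    have hAi : ‖A‖⁻¹ ≤ ρ⁻¹ := inv_anti₀ hA.1 hA.2
    have he' : ‖R c - F c‖ ≤ e c := by rw [norm_sub_rev]; exact he
    have he0 : 0 ≤ e c := (norm_nonneg _).trans he
    have hri : 0 ≤ (r c)⁻¹ := (inv_pos.2 hr).le
    rw [key]
    calc _ ≤ ‖(R c - F c) * (F c)⁻¹ * (R c)⁻¹ * A⁻¹‖ + ‖(R c)⁻¹ * (A⁻¹ - B⁻¹)‖ := norm_add_le _ _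
      _ = ‖R c - F c‖ * ‖F c‖⁻¹ * ‖R c‖⁻¹ * ‖A‖⁻¹ + ‖R c‖⁻¹ * ‖A⁻¹ - B⁻¹‖ := by
          simp only [norm_mul, norm_inv]
      _ ≤ e c * (r c)⁻¹ * (r c)⁻¹ * ρ⁻¹ + (r c)⁻¹ * (ρ⁻¹ * s) := by
          gcongr
      _ = _ := by
          rw [mul_inv, div_eq_mul_inv]
          ring

/-- Termwise `1 - r'/r ≤ log (r/r')`. The logarithm collects the children into a quotient of
products, which the recursion expresses through the parent; the number of children disappears. -/
theorem List.sum_sub_div_le_log_prod {ι : Type*} (l : List ι) (r r' : ι → ℝ)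
    (h : ∀ c ∈ l, 0 < r c ∧ 0 < r' c) :
    (l.map (fun c => (r c - r' c) / r c)).sum ≤
      Real.log ((l.map r).prod / (l.map r').prod) := by
  induction l with
  | nil => simp
  | cons c l ih =>
    obtain ⟨h1, h2⟩ := h c (by simp)
    have hl : ∀ d ∈ l, 0 < r d ∧ 0 < r' d := fun d hd => h d (by simp [hd])
    have hp : 0 < (l.map r).prod := List.prod_pos (by simpa using fun d hd => (hl d hd).1)
    have hp' : 0 < (l.map r').prod := List.prod_pos (by simpa using fun d hd => (hl d hd).2)
    simp only [List.map_cons, List.prod_cons, List.sum_cons]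
    rw [mul_div_mul_comm, Real.log_mul (div_pos h1 h2).ne' (div_pos hp hp').ne']
    refine add_le_add ?_ (ih hl)
    have := Real.log_le_sub_one_of_pos (div_pos h2 h1)
    rw [← inv_div (r' c) (r c), Real.log_inv]
    rw [sub_div, div_self h1.ne']
    linarith

/-- Because `(1 + t + t²/2) (1 - t + t²/2) = 1 + t⁴/4 ≥ 1`. -/
theorem Real.exp_neg_le_one_sub_add_sq {t : ℝ} (ht : 0 ≤ t) :
    Real.exp (-t) ≤ 1 - t + t ^ 2 / 2 := by
  have h : 1 + t + t ^ 2 / 2 ≤ Real.exp t := Real.quadratic_le_exp_of_nonneg ht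
  rw [Real.exp_neg]
  have hq : 0 < 1 + t + t ^ 2 / 2 := by positivity
  refine (inv_anti₀ hq h).trans ?_
  rw [inv_le_iff_one_le_mul₀ hq]
  nlinarith [sq_nonneg (t ^ 2)]

/-- This is where the rate `√α` arises. With `y = x'/x`, the tangent bound at `exp(-√α) y` gives
`log y ≤ √α - 1 + exp(-√α) y`. By the quadratic bound on `exp(-√α)` this exceeds `exp(-√α) (y - 1)`
by at most `α/2`, while `2 log (1+α) ≥ α` is subtracted. -/
theorem mul_log_sub_le {α x x' : ℝ} (hα : 0 < α) (hα1 : α ≤ 1) (hx : 0 < x) (hx' : 0 < x') :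
    x * Real.log (x' / (x * (1 + α) ^ 2)) ≤ Real.exp (-√α) * (x' - x) := by
  have h1α : 0 < 1 + α := by linarith
  have ht : 0 < x' / x := div_pos hx' hx
  rw [← div_div, Real.log_div ht.ne' (by positivity), Real.log_pow]
  have h1 := Real.log_le_sub_one_of_pos (mul_pos (Real.exp_pos (-√α)) ht)
  rw [Real.log_mul (Real.exp_pos _).ne' ht.ne', Real.log_exp] at h1
  have h2 := Real.exp_neg_le_one_sub_add_sq (Real.sqrt_nonneg α)
  rw [Real.sq_sqrt hα.le] at h2
  have h3 : α / 2 ≤ Real.log (1 + α) := by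
    have := Real.one_sub_inv_le_log_of_pos h1α
    refine le_trans ?_ this
    rw [← sub_nonneg]
    have : 1 - (1 + α)⁻¹ - α / 2 = α * (1 - α) / (2 * (1 + α)) := by
      field_simp
      ring
    rw [this]
    have : 0 ≤ 1 - α := by linarith
    positivity
  have h4 : Real.log (x' / x) - 2 * Real.log (1 + α) ≤ Real.exp (-√α) * (x' / x - 1) := by
    linarith
  calc x * (Real.log (x' / x) - (2 : ℕ) * Real.log (1 + α))
      ≤ x * (Real.exp (-√α) * (x' / x - 1)) := by
        push_cast
        exact mul_le_mul_of_nonneg_left h4 hx.le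
    _ = _ := by field_simp

variable {V : Type*} [DecidableEq V] [Fintype V]

theorem exactRatio_pos (G : SimpleGraph V) (P : V → ℝ) (hP : ∀ S, 0 < altPoly G S P)
    (M : Finset V) (v : V) : 0 < exactRatio G P M v :=
  div_pos (hP _) (hP _)

/-- Induction on the number of vertices present: if the children satisfy the bound, their moduli are
at least the real ratios, and the recursion has a smaller numerator over a larger denominator. -/
theorem norm_one_sub_exactRatio_le {K : Type*} [NormedField K] (G : SimpleGraph V) (p : V → K)
    (P : V → ℝ) (hq : ∀ S, altPoly G S p ≠ 0) (hP : ∀ S, 0 < altPoly G S P)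
    (hpP : ∀ v, ‖p v‖ ≤ P v) (adj : V → List V) (hadj : ∀ v w, w ∈ adj v ↔ G.Adj v w)
    (M : Finset V) (v : V) (hv : v ∈ M) :
    ‖1 - exactRatio G p M v‖ ≤ 1 - exactRatio G P M v := by
  induction hn : Mᶜ.card using Nat.strong_induction_on generalizing M v with
  | _ n ih =>
    rw [exactRatio_eq G p hq adj hadj M v hv,
      exactRatio_eq G P (fun S => (hP S).ne') adj hadj M v hv, sub_sub_cancel, sub_sub_cancel,
      norm_div]
    have h := List.prod_pos_le_norm_prod (kids M (adj v)) (fun c => exactRatio G p c.1 c.2)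
      (fun c => exactRatio G P c.1 c.2) (fun c hc => by
        have hc' := snd_mem_fst_of_mem_kids hc
        refine ⟨exactRatio_pos G P hP _ _, ?_⟩
        have h1 := ih c.1ᶜ.card
          (hn ▸ Finset.card_lt_card (Finset.compl_ssubset_compl.2 hc'.2)) c.1 c.2 hc'.1 rfl
        have h2 := norm_sub_norm_le (1 : K) (1 - exactRatio G p c.1 c.2)
        rw [sub_sub_cancel, norm_one] at h2
        linarith)
    exact div_le_div₀ ((norm_nonneg _).trans (hpP v)) (hpP v) h.1 h.2

theorem exactRatio_le_norm {K : Type*} [NormedField K] (G : SimpleGraph V) (p : V → K)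
    (P : V → ℝ) (hq : ∀ S, altPoly G S p ≠ 0) (hP : ∀ S, 0 < altPoly G S P)
    (hpP : ∀ v, ‖p v‖ ≤ P v) (adj : V → List V) (hadj : ∀ v w, w ∈ adj v ↔ G.Adj v w)
    (M : Finset V) (v : V) (hv : v ∈ M) :
    exactRatio G P M v ≤ ‖exactRatio G p M v‖ := by
  have h1 := norm_one_sub_exactRatio_le G p P hq hP hpP adj hadj M v hv
  have h2 := norm_sub_norm_le (1 : K) (1 - exactRatio G p M v)
  rw [sub_sub_cancel, norm_one] at h2
  linarith

/-- Scaling multiplies the numerator of the recursion by `t` and can only decrease the ratios in the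
denominator. This bounds the potential from below at depth `0`. -/
theorem mul_one_sub_exactRatio_le (G : SimpleGraph V) (P P' : V → ℝ) (t : ℝ) (ht : 1 ≤ t)
    (hP : ∀ S, 0 < altPoly G S P) (hP' : ∀ S, 0 < altPoly G S P') (h0 : ∀ v, 0 ≤ P v)
    (hPP' : ∀ v, P' v = t * P v)
    (adj : V → List V) (hadj : ∀ v w, w ∈ adj v ↔ G.Adj v w)
    (M : Finset V) (v : V) (hv : v ∈ M) :
    t * (1 - exactRatio G P M v) ≤ 1 - exactRatio G P' M v := by
  rw [exactRatio_eq G P (fun S => (hP S).ne') adj hadj M v hv,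
    exactRatio_eq G P' (fun S => (hP' S).ne') adj hadj M v hv, sub_sub_cancel, sub_sub_cancel,
    hPP', ← mul_div_assoc]
  have h := List.prod_pos_le_norm_prod (kids M (adj v)) (fun c => exactRatio G P c.1 c.2)
    (fun c => exactRatio G P' c.1 c.2) (fun c hc =>
      ⟨exactRatio_pos G P' hP' _ _, exactRatio_le_norm G P P' (fun S => (hP S).ne') hP'
        (fun v => by
          rw [hPP', Real.norm_eq_abs, abs_of_nonneg (h0 v)]
          exact le_mul_of_one_le_left (h0 v) ht) adj hadj _ _ (snd_mem_fst_of_mem_kids hc).1⟩)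
  have hpos : 0 < ((kids M (adj v)).map (fun c => exactRatio G P c.1 c.2)).prod :=
    List.prod_pos (fun a ha => by
      obtain ⟨c, -, rfl⟩ := List.mem_map.1 ha
      exact exactRatio_pos G P hP _ _)
  rw [Real.norm_eq_abs, abs_of_pos hpos] at h
  exact div_le_div_of_nonneg_left (mul_nonneg (zero_le_one.trans ht) (h0 v)) h.1 h.2

/-- The truncation at depth `D` of the recursion satisfied by `exactRatio`. -/
noncomputable def ratio (adj : V → List V) (p : V → ℂ) : ℕ → Finset V → V → ℂ
  | 0, _, _ => 1
  | D + 1, M, v => 1 - p v / ((kids M (adj v)).map (fun c => ratio adj p D c.1 c.2)).prod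

/-- Exponential decay of the truncation error, at a rate of order `√α`. -/
theorem norm_ratio_sub_exactRatio_le (G : SimpleGraph V) (p : V → ℂ) (α : ℝ) (hα : 0 < α)
    (hα1 : α ≤ 1) (P P' : V → ℝ) (hq : ∀ S, altPoly G S p ≠ 0)
    (hP : ∀ S, 0 < altPoly G S P) (hP' : ∀ S, 0 < altPoly G S P')
    (hpP : ∀ v, P v = ‖p v‖) (hPP' : ∀ v, P' v = (1 + α) ^ 2 * P v)
    (adj : V → List V) (hadj : ∀ v w, w ∈ adj v ↔ G.Adj v w)
    (D : ℕ) (M : Finset V) (v : V) (hv : v ∈ M) :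
    ‖1 - ratio adj p D M v‖ ≤ 1 - exactRatio G P M v ∧
    ‖ratio adj p D M v - exactRatio G p M v‖ ≤
      1 / (2 * α) * Real.exp (-√α) ^ D * (exactRatio G P M v - exactRatio G P' M v) := by
  have h0 : ∀ v, 0 ≤ P v := fun v => by rw [hpP]; exact norm_nonneg _
  have hle : ∀ v, ‖p v‖ ≤ P v := fun v => (hpP v).ge
  have ht : 1 ≤ (1 + α) ^ 2 := by nlinarith
  have hx := norm_one_sub_exactRatio_le G p P hq hP hle adj hadj
  have hx0 : ∀ M v, v ∈ M → 0 ≤ 1 - exactRatio G P M v :=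
    fun M v hv => (norm_nonneg _).trans (hx M v hv)
  have hg := mul_one_sub_exactRatio_le G P P' _ ht hP hP' h0 hPP' adj hadj
  induction D generalizing M v with
  | zero =>
    simp only [ratio, sub_self, norm_zero, pow_zero, mul_one]
    refine ⟨hx0 M v hv, (hx M v hv).trans ?_⟩
    -- Here the factor `1 / (2 * α)` originates: `r - r' ≥ ((1+α)² - 1) (1 - r) ≥ 2α (1 - r)`.
    rw [div_mul_eq_mul_div, one_mul, le_div_iff₀ (by positivity)]
    nlinarith [hg M v hv, hx0 M v hv, mul_nonneg (sq_nonneg α) (hx0 M v hv)]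
  | succ D ih =>
    have hkid : ∀ c ∈ kids M (adj v), 0 < exactRatio G P c.1 c.2 ∧
        exactRatio G P c.1 c.2 ≤ ‖ratio adj p D c.1 c.2‖ := by
      intro c hc
      refine ⟨exactRatio_pos G P hP _ _, ?_⟩
      have h1 := (ih c.1 c.2 (snd_mem_fst_of_mem_kids hc).1).1
      have h2 := norm_sub_norm_le (1 : ℂ) (1 - ratio adj p D c.1 c.2)
      rw [sub_sub_cancel, norm_one] at h2
      linarith
    have hprod := List.prod_pos_le_norm_prod _ _ _ hkid
    have hr := exactRatio_eq G P (fun S => (hP S).ne') adj hadj M v hv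
    have hr' := exactRatio_eq G P' (fun S => (hP' S).ne') adj hadj M v hv
    have hrp := exactRatio_eq G p hq adj hadj M v hv
    have hinv := List.norm_inv_prod_sub_inv_prod_le (kids M (adj v))
      (fun c => ratio adj p D c.1 c.2) (fun c => exactRatio G p c.1 c.2)
      (fun c => exactRatio G P c.1 c.2)
      (fun c => 1 / (2 * α) * Real.exp (-√α) ^ D *
        (exactRatio G P c.1 c.2 - exactRatio G P' c.1 c.2))
      (fun c hc => ⟨(hkid c hc).1, (hkid c hc).2,
        exactRatio_le_norm G p P hq hP hle adj hadj _ _ (snd_mem_fst_of_mem_kids hc).1,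
        (ih c.1 c.2 (snd_mem_fst_of_mem_kids hc).1).2⟩)
    have hlog := List.sum_sub_div_le_log_prod (kids M (adj v))
      (fun c => exactRatio G P c.1 c.2) (fun c => exactRatio G P' c.1 c.2)
      (fun c _ => ⟨exactRatio_pos G P hP _ _, exactRatio_pos G P' hP' _ _⟩)
    have hpos' : 0 < ((kids M (adj v)).map (fun c => exactRatio G P' c.1 c.2)).prod :=
      List.prod_pos (fun a ha => by
        obtain ⟨c, -, rfl⟩ := List.mem_map.1 ha
        exact exactRatio_pos G P' hP' _ _)
    constructor
    · rw [ratio, sub_sub_cancel, norm_div, hr, sub_sub_cancel, hpP]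
      exact div_le_div_of_nonneg_left (norm_nonneg _) hprod.1 hprod.2
    · set x := 1 - exactRatio G P M v with hxdef
      set x' := 1 - exactRatio G P' M v with hxdef'
      have hdiff : exactRatio G P M v - exactRatio G P' M v = x' - x := by
        rw [hxdef, hxdef']
        ring
      have hxe : x = P v * (((kids M (adj v)).map
          (fun c => exactRatio G P c.1 c.2)).prod)⁻¹ := by
        rw [hxdef, hr, sub_sub_cancel, div_eq_mul_inv]
      have hxe' : x' = (1 + α) ^ 2 * P v * (((kids M (adj v)).map
          (fun c => exactRatio G P' c.1 c.2)).prod)⁻¹ := by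
        rw [hxdef', hr', sub_sub_cancel, div_eq_mul_inv, hPP']
      set A := (1 / (2 * α) * Real.exp (-√α) ^ D) with hA
      have hA0 : 0 ≤ A := by positivity
      have hsum : ((kids M (adj v)).map (fun c => A *
          (exactRatio G P c.1 c.2 - exactRatio G P' c.1 c.2) / exactRatio G P c.1 c.2)).sum =
          A * ((kids M (adj v)).map (fun c =>
          (exactRatio G P c.1 c.2 - exactRatio G P' c.1 c.2) / exactRatio G P c.1 c.2)).sum := by
        rw [← List.sum_map_mul_left]
        simp only [mul_div_assoc]
      rw [hsum] at hinv
      have hx0' : 0 ≤ x := hx0 M v hv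
      have hstep : ‖ratio adj p (D + 1) M v - exactRatio G p M v‖ ≤
          A * (x * Real.log (((kids M (adj v)).map (fun c => exactRatio G P c.1 c.2)).prod /
            ((kids M (adj v)).map (fun c => exactRatio G P' c.1 c.2)).prod)) := by
        rw [ratio, hrp, sub_sub_sub_cancel_left, div_eq_mul_inv, div_eq_mul_inv, ← mul_sub,
          norm_mul, norm_sub_rev, ← hpP]
        refine (mul_le_mul_of_nonneg_left hinv (h0 v)).trans ?_
        rw [← mul_assoc, ← hxe, mul_left_comm]
        exact mul_le_mul_of_nonneg_left (mul_le_mul_of_nonneg_left hlog hx0') hA0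
      rw [hdiff, pow_succ, ← mul_assoc, ← hA]
      refine hstep.trans ?_
      rw [mul_assoc A]
      refine mul_le_mul_of_nonneg_left ?_ hA0
      -- If `P v = 0`, both sides vanish; this case is separate because the logarithmic inequality
      -- needs `x > 0`.
      rcases (h0 v).eq_or_lt with hPv | hPv
      · have e1 : x = 0 := by rw [hxe, ← hPv, zero_mul]
        have e2 : x' = 0 := by rw [hxe', ← hPv, mul_zero, zero_mul]
        simp [e1, e2]
      · have hxp : 0 < x := by rw [hxe]; exact mul_pos hPv (inv_pos.2 hprod.1)
        have hxp' : 0 < x' := by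
          rw [hxe']
          exact mul_pos (mul_pos (by positivity) hPv) (inv_pos.2 hpos')
        have := mul_log_sub_le hα hα1 hxp hxp'
        -- The factor `(1+α)²` between the two numerators is exactly what the contraction inequality
        -- divides out.
        have e : x' / (x * (1 + α) ^ 2) =
            ((kids M (adj v)).map (fun c => exactRatio G P c.1 c.2)).prod /
            ((kids M (adj v)).map (fun c => exactRatio G P' c.1 c.2)).prod := by
          rw [hxe, hxe']
          have := hprod.1.ne'
          have := hpos'.ne'
          have := hPv.ne'
          have : (1 + α) ^ 2 ≠ 0 := by positivity
          field_simp
        rwa [e] at this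

end RatioBounds

/-! ### From the ratios to the polynomial -/

section Approximation

theorem List.norm_prod_sub_prod_le {ι : Type*} (l : List ι) (F R : ι → ℂ) (ε : ℝ) (hε : 0 ≤ ε)
    (h : ∀ c ∈ l, ‖F c - R c‖ ≤ ε * ‖R c‖) :
    ‖(l.map F).prod - (l.map R).prod‖ ≤ ((1 + ε) ^ l.length - 1) * ‖(l.map R).prod‖ := by
  induction l with
  | nil => simp
  | cons c l ih =>
    have h1 := h c (by simp)
    have ih := ih (fun d hd => h d (by simp [hd]))
    simp only [List.map_cons, List.prod_cons, List.length_cons]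
    set A := (l.map F).prod
    set B := (l.map R).prod
    have key : F c * A - R c * B = (F c - R c) * (A - B) + (F c - R c) * B + R c * (A - B) := by
      ring
    have hpow : 1 ≤ (1 + ε) ^ l.length := one_le_pow₀ (by linarith)
    rw [key]
    calc _ ≤ ‖F c - R c‖ * ‖A - B‖ + ‖F c - R c‖ * ‖B‖ + ‖R c‖ * ‖A - B‖ := by
          rw [← norm_mul, ← norm_mul, ← norm_mul]
          exact norm_add₃_le
      _ ≤ (ε * ‖R c‖) * (((1 + ε) ^ l.length - 1) * ‖B‖) + (ε * ‖R c‖) * ‖B‖ +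
          ‖R c‖ * (((1 + ε) ^ l.length - 1) * ‖B‖) := by
          gcongr
      _ = _ := by
          rw [norm_mul, pow_succ]
          ring

theorem one_add_pow_sub_one_le {ε : ℝ} (hε : 0 ≤ ε) (n : ℕ) (hn : ε * n ≤ 1) :
    (1 + ε) ^ n - 1 ≤ 2 * (ε * n) := by
  have h1 : (1 + ε) ^ n ≤ Real.exp (ε * n) := by
    rw [mul_comm, Real.exp_nat_mul]
    exact pow_le_pow_left₀ (by linarith) (by rw [add_comm]; exact Real.add_one_le_exp ε) n
  have h0 : 0 ≤ ε * n := by positivity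
  have h2 := Real.abs_exp_sub_one_le (x := ε * n) (by rwa [abs_of_nonneg h0])
  rw [abs_of_nonneg h0] at h2
  have h3 := le_abs_self (Real.exp (ε * n) - 1)
  linarith

theorem length_kids_le {V : Type*} [DecidableEq V] (ws : List V) (M : Finset V) :
    (kids M ws).length ≤ ws.length := by
  induction ws generalizing M with
  | nil => simp [kids]
  | cons w ws ih =>
    rw [kids]
    split_ifs
    · exact (ih M).trans (Nat.le_succ _)
    · simpa using ih _

/-- The factor `4` in `ℓ` would even give the fourth power of `ε * α / n`; only the first power is
kept, and then the `n` is dropped. -/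
theorem exp_neg_sqrt_pow_le {n : ℕ} (hn : 0 < n) {α ε ℓ : ℝ} (hα : 0 < α) (hα1 : α ≤ 1)
    (hε : 0 < ε) (hεn : ε ≤ 1 / (n : ℝ)) (hℓ : 4 / √α * Real.log (n / (ε * α)) ≤ ℓ) :
    Real.exp (-√α) ^ ⌈ℓ⌉₊ ≤ ε * α := by
  have hn1 : (1 : ℝ) ≤ n := by exact_mod_cast hn
  have hn0 : (0 : ℝ) < n := by linarith
  have hs : 0 < √α := Real.sqrt_pos.2 hα
  have hεα : 0 < ε * α := mul_pos hε hα
  have hε1 : ε ≤ 1 := hεn.trans ((div_le_one hn0).2 hn1)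
  have hεα1 : ε * α ≤ 1 := mul_le_one₀ hε1 hα.le hα1
  have hlog : 0 ≤ Real.log (n / (ε * α)) :=
    Real.log_nonneg ((one_le_div hεα).2 (hεα1.trans hn1))
  have h1 : 4 * Real.log (n / (ε * α)) ≤ √α * ⌈ℓ⌉₊ := by
    have h := mul_le_mul_of_nonneg_left (hℓ.trans (Nat.le_ceil ℓ)) hs.le
    have e : √α * (4 / √α * Real.log (n / (ε * α))) = 4 * Real.log (n / (ε * α)) := by
      field_simp
    rwa [e] at h
  rw [← Real.exp_nat_mul]
  calc Real.exp (⌈ℓ⌉₊ * -√α) ≤ Real.exp (- Real.log (n / (ε * α))) := by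
        rw [Real.exp_le_exp]
        linarith
    _ = ε * α / n := by
        rw [Real.exp_neg, Real.exp_log (div_pos hn0 hεα), inv_div]
    _ ≤ ε * α := div_le_self hεα.le hn1

theorem norm_smul_parameter {n : ℕ} (p : Fin n → ℂ) {α : ℝ} (hα : 0 < α) (v : Fin n) :
    ‖(1 + (α : ℂ)) ^ 2 * p v‖ = (1 + α) ^ 2 * ‖p v‖ := by
  have : (1 + (α : ℂ)) = ((1 + α : ℝ) : ℂ) := by push_cast; rfl
  rw [norm_mul, norm_pow, this, Complex.norm_real, Real.norm_eq_abs, abs_of_pos (by linarith)]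

/-- The potential is at most `r ≤ |R|`, which makes the error relative. Nonvanishing follows from
`|1 - ratio| ≤ 1 - r < 1` and ensures that the program never divides by zero. -/
theorem ratio_estimates {n : ℕ} (G : SimpleGraph (Fin n)) (p : Fin n → ℂ) (α : ℝ) (hα : 0 < α)
    (hα1 : α ≤ 1) (hp : (fun v => (1 + (α : ℂ)) ^ 2 * p v) ∈ shearerRegion G)
    (adj : Fin n → List (Fin n)) (hadj : ∀ v w, w ∈ adj v ↔ G.Adj v w)
    (D : ℕ) (M : Finset (Fin n)) (v : Fin n) (hv : v ∈ M) :
    ratio adj p D M v ≠ 0 ∧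
    ‖ratio adj p D M v - exactRatio G p M v‖ ≤
      1 / (2 * α) * Real.exp (-√α) ^ D * ‖exactRatio G p M v‖ := by
  have ht : 1 ≤ (1 + α) ^ 2 := by nlinarith
  have hp1 : p ∈ shearerRegion G := shearerRegion_mono G hp (fun v => by
    rw [norm_smul_parameter p hα]
    exact le_mul_of_one_le_left (norm_nonneg _) ht)
  have hq := altPoly_ne_zero_of_mem_shearerRegion G p hp1
  have hP := altPoly_pos_of_mem_shearerRegion G p hp1
  have hP' := altPoly_pos_of_mem_shearerRegion G _ hp
  obtain ⟨h1, h2⟩ := norm_ratio_sub_exactRatio_le G p α hα hα1 (fun v => ‖p v‖) _ hq hP hP'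
    (fun _ => rfl) (fun v => norm_smul_parameter p hα v) adj hadj D M v hv
  have hr := exactRatio_pos G _ hP M v
  have hr' := exactRatio_pos G _ hP' M v
  have hle := exactRatio_le_norm G p _ hq hP (fun _ => le_rfl) adj hadj M v hv
  constructor
  · intro h0
    rw [h0, sub_zero, norm_one] at h1
    linarith
  · refine h2.trans (mul_le_mul_of_nonneg_left ?_ (by positivity))
    linarith

/-- The product of the truncated ratios approximates the alternating independence polynomial. -/
theorem norm_prod_ratio_sub_altIndepPoly_le {n : ℕ} (hn : 0 < n) (G : SimpleGraph (Fin n))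
    (p : Fin n → ℂ) (α ε ℓ : ℝ) (hα : 0 < α) (hα1 : α ≤ 1) (hε : 0 < ε) (hεn : ε ≤ 1 / (n : ℝ))
    (hp : (fun v => (1 + (α : ℂ)) ^ 2 * p v) ∈ shearerRegion G)
    (hℓ : 4 / √α * Real.log (n / (ε * α)) ≤ ℓ)
    (adj : Fin n → List (Fin n)) (hadj : ∀ v w, w ∈ adj v ↔ G.Adj v w) :
    ‖((kids ∅ (List.finRange n)).map (fun c => ratio adj p ⌈ℓ⌉₊ c.1 c.2)).prod -
        altIndepPoly G Finset.univ p‖ ≤ 2 * (ε * n) * ‖altIndepPoly G Finset.univ p‖ := by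
  have ht : 1 ≤ (1 + α) ^ 2 := by nlinarith
  have hq := altPoly_ne_zero_of_mem_shearerRegion G p (shearerRegion_mono G hp (fun v => by
    rw [norm_smul_parameter p hα]
    exact le_mul_of_one_le_left (norm_nonneg _) ht))
  have hn0 : (0 : ℝ) < n := by exact_mod_cast hn
  have hexact : ((kids ∅ (List.finRange n)).map (fun c => exactRatio G p c.1 c.2)).prod =
      altIndepPoly G Finset.univ p := by
    rw [prod_kids_exactRatio G p hq, altIndepPoly_eq_altPoly]
    have : (∅ᶜ : Finset (Fin n)).filter (fun w => w ∉ List.finRange n) = ∅ := by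
      ext x
      simp
    rw [this, altPoly_empty, div_one, Finset.compl_empty]
  rw [← hexact]
  refine (List.norm_prod_sub_prod_le _ _ _ ε hε.le (fun c hc => ?_)).trans
    (mul_le_mul_of_nonneg_right ?_ (norm_nonneg _))
  · refine (ratio_estimates G p α hα hα1 hp adj hadj _ _ _
      (snd_mem_fst_of_mem_kids hc).1).2.trans (mul_le_mul_of_nonneg_right ?_ (norm_nonneg _))
    -- The `α` gained from the depth cancels the `1 / (2 * α)`: each factor has relative error at
    -- most `ε / 2`.
    have h := exp_neg_sqrt_pow_le hn hα hα1 hε hεn hℓ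
    rw [div_mul_eq_mul_div, one_mul, div_le_iff₀ (by positivity)]
    nlinarith [mul_pos hε hα]
  · refine le_trans ?_ (one_add_pow_sub_one_le hε.le n ?_)
    · refine sub_le_sub_right (pow_le_pow_right₀ (by linarith) ?_) 1
      simpa using length_kids_le (List.finRange n) ∅
    · rwa [le_div_iff₀ hn0] at hεn

end Approximation

/-! ### Self-avoiding walks as lists of vertices -/

section SelfAvoidingWalks

variable {V : Type*}

/-- The self-avoiding walks of length at most `D` starting at `v`, as lists of vertices beginning
with the endpoint. -/
def revSaws (G : SimpleGraph V) (v : V) (D : ℕ) : Set (List V) :=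
  {l | l.Nodup ∧ l.IsChain G.Adj ∧ [v] <:+ l ∧ l.length ≤ D + 1}

theorem finite_revSaws [Finite V] (G : SimpleGraph V) (v : V) (D : ℕ) :
    (revSaws G v D).Finite :=
  (List.finite_length_le V (D + 1)).subset (fun _ hl => hl.2.2.2)

theorem SimpleGraph.isChain_adj_reverse (G : SimpleGraph V) (l : List V) :
    l.reverse.IsChain G.Adj ↔ l.IsChain G.Adj := by
  rw [List.isChain_reverse]
  simp only [G.adj_comm]

theorem ncard_revSaws_le [Finite V] (G : SimpleGraph V) (v : V) (D : ℕ) :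
    (revSaws G v D).ncard ≤ ∑ i ∈ range (D + 1), sawCount G v i := by
  classical
  have hinj : Function.Injective (fun w : (Σ u, G.Walk v u) => w.2.support) := by
    rintro ⟨u, w⟩ ⟨u', w'⟩ h
    have h : w.support = w'.support := h
    have hu : u = u' := by
      rw [← w.getLast_support, ← w'.getLast_support]
      simp only [h]
    subst hu
    rw [SimpleGraph.Walk.ext_support h]
  have hfin : ∀ i, {w : Σ u, G.Walk v u | w.2.IsPath ∧ w.2.length = i}.Finite := by
    intro i
    refine Set.Finite.of_finite_image
      (f := fun w : (Σ u, G.Walk v u) => w.2.support) ?_ hinj.injOn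
    refine (List.finite_length_le V (i + 1)).subset ?_
    rintro _ ⟨w, hw, rfl⟩
    simp [hw.2]
  have hsub : (finite_revSaws G v D).toFinset ⊆ (range (D + 1)).biUnion
      (fun i => (hfin i).toFinset.image (fun w => w.2.support.reverse)) := by
    intro l hl
    obtain ⟨hnd, hch, ⟨b, rfl⟩, hlen⟩ := (finite_revSaws G v D).mem_toFinset.1 hl
    rw [Finset.mem_biUnion]
    have hch' := (G.isChain_adj_reverse _).2 hch
    have hne : (b ++ [v]).reverse ≠ [] := by simp
    have hhead : (b ++ [v]).reverse.head hne = v := by simp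
    refine ⟨b.length, by simpa using hlen, ?_⟩
    rw [Finset.mem_image]
    have hs := SimpleGraph.Walk.support_ofSupport hne hch'
    have hl := SimpleGraph.Walk.length_ofSupport hne hch'
    generalize SimpleGraph.Walk.ofSupport (b ++ [v]).reverse hne hch' = w at hs hl
    revert w
    rw [hhead]
    intro w hs hl
    refine ⟨⟨_, w⟩, ?_, ?_⟩
    · rw [Set.Finite.mem_toFinset]
      refine ⟨?_, by simpa using hl⟩
      rw [SimpleGraph.Walk.isPath_def, hs]
      exact List.nodup_reverse.2 hnd
    · simp [hs]
  rw [Set.ncard_eq_toFinset_card _ (finite_revSaws G v D)]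
  refine (Finset.card_le_card hsub).trans (Finset.card_biUnion_le.trans ?_)
  refine Finset.sum_le_sum (fun i _ => Finset.card_image_le.trans ?_)
  rw [sawCount, Set.ncard_eq_toFinset_card _ (hfin i)]

end SelfAvoidingWalks

/-! ### Size of the recursion tree -/

section RecursionTree

variable {V : Type*} [DecidableEq V]

/-- The number of elementary steps of the evaluation of `ratio adj p D M v`. -/
def nodeSteps (adj : V → List V) : ℕ → Finset V → V → ℕ
  | 0, _, _ => 0
  | D + 1, M, v => 2 * (adj v).length + 1 +
      ((kids M (adj v)).map (fun c => nodeSteps adj D c.1 c.2)).sum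

/-- The nodes of the recursion tree of `ratio adj p D M v`; a node is given by the list of the
vertices on the path to it, beginning with the endpoint. -/
def prunedWalks (adj : V → List V) : ℕ → Finset V → V → List V → List (List V)
  | 0, _, _, _ => []
  | D + 1, M, v, t => (v :: t) ::
      (kids M (adj v)).flatMap (fun c => prunedWalks adj D c.1 c.2 (v :: t))

/-- The adjacency list of the first entry of a list of vertices. -/
def headAdj (adj : V → List V) : List V → List V
  | [] => []
  | u :: _ => adj u

theorem nodeSteps_eq_sum (adj : V → List V) (D : ℕ) (M : Finset V) (v : V) (t : List V) :
    nodeSteps adj D M v =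
      ((prunedWalks adj D M v t).map (fun l => 2 * (headAdj adj l).length + 1)).sum := by
  induction D generalizing M v t with
  | zero => simp [nodeSteps, prunedWalks]
  | succ D ih =>
    rw [nodeSteps, prunedWalks, List.map_cons, List.sum_cons, headAdj, List.map_flatMap,
      List.flatMap_def, List.sum_flatten, List.map_map]
    congr 2
    exact List.map_congr_left (fun c _ => ih c.1 c.2 (v :: t))

/-- The list is processed in order, so everything up to the position of the chosen vertex is already
removed. The pruning of the tree rests on this. -/
theorem mem_kids_spec {ws : List V} {M : Finset V} {c : Finset V × V} (hc : c ∈ kids M ws) :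
    c.2 ∈ ws ∧ c.2 ∉ M ∧ ∀ x ∈ ws, ws.idxOf x ≤ ws.idxOf c.2 → x ∈ c.1 := by
  induction ws generalizing M with
  | nil => simp [kids] at hc
  | cons w ws ih =>
    have hM := (snd_mem_fst_of_mem_kids hc).2.1
    have tail : c.2 ≠ w → w ∈ c.1 → (∀ x ∈ ws, ws.idxOf x ≤ ws.idxOf c.2 → x ∈ c.1) →
        ∀ x ∈ w :: ws, (w :: ws).idxOf x ≤ (w :: ws).idxOf c.2 → x ∈ c.1 := by
      intro hne hw h x hx hle
      by_cases hxw : x = w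
      · exact hxw ▸ hw
      · rw [List.idxOf_cons_ne _ (Ne.symm hxw), List.idxOf_cons_ne _ (Ne.symm hne)] at hle
        exact h x ((List.mem_cons.1 hx).resolve_left hxw) (by omega)
    rw [kids] at hc
    split_ifs at hc with hw
    · obtain ⟨h1, h2, h3⟩ := ih hc
      exact ⟨List.mem_cons_of_mem _ h1, h2, tail (fun h => h2 (h ▸ hw)) (hM hw) h3⟩
    · rcases List.mem_cons.1 hc with rfl | hc
      · refine ⟨by simp, hw, ?_⟩
        intro x hx hle
        by_cases hxw : x = w
        · exact hxw ▸ Finset.mem_insert_self _ _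
        · rw [List.idxOf_cons_ne _ (Ne.symm hxw), List.idxOf_cons_self] at hle
          omega
      · obtain ⟨h1, h2, h3⟩ := ih hc
        have hne : c.2 ≠ w := fun h => h2 (h ▸ Finset.mem_insert_self _ _)
        exact ⟨List.mem_cons_of_mem _ h1, fun h => h2 (Finset.mem_insert_of_mem h), tail hne
          ((snd_mem_fst_of_mem_kids hc).2.1 (Finset.mem_insert_self _ _)) h3⟩

theorem pairwise_kids (ws : List V) (M : Finset V) :
    (kids M ws).Pairwise (fun c d => c.2 ≠ d.2) := by
  induction ws generalizing M with
  | nil => simp [kids]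
  | cons w ws ih =>
    rw [kids]
    split_ifs
    · exact ih M
    · refine List.pairwise_cons.2 ⟨fun d hd h => ?_, ih _⟩
      exact (mem_kids_spec hd).2.1 (h ▸ Finset.mem_insert_self _ _)

theorem suffix_of_mem_prunedWalks (adj : V → List V) {D : ℕ} {M : Finset V} {v : V}
    {t l : List V} (hl : l ∈ prunedWalks adj D M v t) :
    v :: t <:+ l ∧ l.length ≤ t.length + D := by
  induction D generalizing M v t with
  | zero => simp [prunedWalks] at hl
  | succ D ih =>
    rw [prunedWalks] at hl
    rcases List.mem_cons.1 hl with rfl | hl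
    · exact ⟨List.suffix_rfl, by simp⟩
    · obtain ⟨c, -, hc⟩ := List.mem_flatMap.1 hl
      obtain ⟨h1, h2⟩ := ih hc
      exact ⟨(List.suffix_cons _ _).trans h1, by simp at h2; omega⟩

theorem nodup_prunedWalks (adj : V → List V) (D : ℕ) (M : Finset V) (v : V) (t : List V) :
    (prunedWalks adj D M v t).Nodup := by
  induction D generalizing M v t with
  | zero => simp [prunedWalks]
  | succ D ih =>
    rw [prunedWalks, List.nodup_cons]
    constructor
    · intro h
      obtain ⟨c, -, hc⟩ := List.mem_flatMap.1 h
      have := (suffix_of_mem_prunedWalks adj hc).1.length_le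
      simp at this
    · refine List.nodup_flatMap.2 ⟨fun c _ => ih _ _ _, (pairwise_kids _ _).imp ?_⟩
      intro c d hcd l hc hd
      have h1 := (suffix_of_mem_prunedWalks adj hc).1
      have h2 := (suffix_of_mem_prunedWalks adj hd).1
      -- Two suffixes of equal length of one list coincide, whereas those of different children
      -- differ in their first vertex.
      have := (List.suffix_of_suffix_length_le h1 h2 (by simp)).eq_of_length (by simp)
      simp at this
      exact hcd this

/-- Invariant of the nodes of the recursion tree: `l` is a self-avoiding walk (beginning with its
endpoint), all its vertices and all vertices that precede a successor in the adjacency list of the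
predecessor are removed, and no vertex precedes the chosen successor of an earlier one. -/
structure PrunedWalk (G : SimpleGraph V) (adj : V → List V) (M : Finset V) (l : List V) : Prop where
  nodup : l.Nodup
  chain : l.IsChain G.Adj
  subset : ∀ x ∈ l, x ∈ M
  removed : ∀ a z y b, l = a ++ z :: y :: b →
    ∀ x ∈ adj y, (adj y).idxOf x ≤ (adj y).idxOf z → x ∈ M
  later : ∀ a z y b, l = a ++ z :: y :: b → ∀ e ∈ a, (adj y).idxOf z ≤ (adj y).idxOf e

theorem PrunedWalk.cons {G : SimpleGraph V} {adj : V → List V}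
    (hadj : ∀ v w, w ∈ adj v ↔ G.Adj v w) {M : Finset V} {v : V} {t : List V}
    (h : PrunedWalk G adj M (v :: t)) {c : Finset V × V} (hc : c ∈ kids M (adj v)) :
    PrunedWalk G adj c.1 (c.2 :: v :: t) := by
  obtain ⟨h1, h2, h3⟩ := mem_kids_spec hc
  obtain ⟨h4, h5⟩ := snd_mem_fst_of_mem_kids hc
  refine ⟨?_, ?_, ?_, ?_, ?_⟩
  · exact List.nodup_cons.2 ⟨fun hv => h2 (h.subset _ hv), h.nodup⟩
  · exact List.isChain_cons_cons.2 ⟨((hadj _ _).1 h1).symm, h.chain⟩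
  · intro x hx
    rcases List.mem_cons.1 hx with rfl | hx
    · exact h4
    · exact h5.1 (h.subset x hx)
  · intro a z y b hl x hx hle
    rcases a with _ | ⟨e, a⟩
    · simp only [List.nil_append, List.cons.injEq] at hl
      obtain ⟨rfl, rfl, rfl⟩ := hl
      exact h3 x hx hle
    · simp only [List.cons_append, List.cons.injEq] at hl
      exact h5.1 (h.removed a z y b hl.2 x hx hle)
  · intro a z y b hl e he
    rcases a with _ | ⟨e', a⟩
    · simp at he
    · simp only [List.cons_append, List.cons.injEq] at hl
      rcases List.mem_cons.1 he with rfl | he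
      -- A new vertex listed before `z` at `y` would already have been removed. Vertices not listed
      -- at `y` have the index `(adj y).length` and cause no violation.
      · by_contra! hlt
        have hmem : e ∈ adj y := List.idxOf_lt_length_iff.1 (hlt.trans_le List.idxOf_le_length)
        exact h2 (hl.1 ▸ h.removed a z y b hl.2 e hmem hlt.le)
      · exact h.later a z y b hl.2 e he

theorem PrunedWalk.of_mem_prunedWalks {G : SimpleGraph V} {adj : V → List V}
    (hadj : ∀ v w, w ∈ adj v ↔ G.Adj v w) {D : ℕ} {M : Finset V} {v : V} {t l : List V}
    (h : PrunedWalk G adj M (v :: t)) (hl : l ∈ prunedWalks adj D M v t) :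
    ∃ M', PrunedWalk G adj M' l := by
  induction D generalizing M v t with
  | zero => simp [prunedWalks] at hl
  | succ D ih =>
    rw [prunedWalks] at hl
    rcases List.mem_cons.1 hl with rfl | hl
    · exact ⟨M, h⟩
    · obtain ⟨c, hc, hl⟩ := List.mem_flatMap.1 hl
      exact ih (h.cons hadj hc) hl

theorem PrunedWalk.singleton (G : SimpleGraph V) (adj : V → List V) {M : Finset V} {v : V}
    (hv : v ∈ M) : PrunedWalk G adj M [v] := by
  have hno : ∀ a z y b, [v] ≠ a ++ z :: y :: b := by
    intro a z y b h
    have := congrArg List.length h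
    simp at this
    omega
  exact ⟨by simp, by simp, by simpa using hv, fun a z y b h => absurd h (hno a z y b),
    fun a z y b h => absurd h (hno a z y b)⟩

/-- Reversal of the part of a list before the first occurrence of `y`. -/
def rotateAt (l : List V) (y : V) : List V :=
  (l.takeWhile (fun x => decide (x ≠ y))).reverse ++ l.dropWhile (fun x => decide (x ≠ y))

theorem rotateAt_append {a b : List V} {y : V} (hy : y ∉ a) :
    rotateAt (a ++ y :: b) y = a.reverse ++ y :: b := by
  have h : ∀ x ∈ a, decide (x ≠ y) = true := by
    intro x hx
    rw [decide_eq_true_iff]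
    exact fun h => hy (h ▸ hx)
  rw [rotateAt, List.takeWhile_append_of_pos h, List.dropWhile_append_of_pos h]
  simp

/-- Since `y` is neither the endpoint `e` nor its predecessor, its successor `z` on the walk is
different from `e`; the rotation makes `z` the new endpoint. -/
theorem exists_chord_decomposition {l : List V} (hl : l.Nodup) {y : V} (hy : y ∈ l.tail.tail) :
    ∃ e c z b, l = e :: c ++ z :: y :: b ∧ rotateAt l y = z :: (c.reverse ++ e :: y :: b) := by
  rcases l with _ | ⟨e, _ | ⟨f, t⟩⟩
  · simp at hy
  · simp at hy
  · obtain ⟨a, b, rfl⟩ := List.mem_iff_append.1 hy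
    have hne : f :: a ≠ [] := by simp
    obtain ⟨c, z, hcz⟩ : ∃ c z, f :: a = c ++ [z] :=
      ⟨_, _, (List.dropLast_append_getLast hne).symm⟩
    have e1 : e :: f :: (a ++ y :: b) = (e :: c ++ [z]) ++ y :: b := by
      rw [List.cons_append, List.cons_append, ← hcz]
      simp
    rw [e1] at hl ⊢
    refine ⟨e, c, z, b, by simp, ?_⟩
    rw [rotateAt_append]
    · simp
    · intro h
      exact (List.nodup_append.1 hl).2.2 y h y (by simp) rfl

/-- A neighbour of the endpoint lies off the walk, or is its predecessor, or closes a chord; the `1`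
counts the predecessor. -/
theorem headAdj_length_le {G : SimpleGraph V} {adj : V → List V}
    (hadj : ∀ v w, w ∈ adj v ↔ G.Adj v w) (hnd : ∀ v, (adj v).Nodup) (l : List V) :
    (headAdj adj l).length ≤ ((headAdj adj l).toFinset.filter (fun w => w ∉ l)).card + 1 +
      ((headAdj adj l).toFinset.filter (fun w => w ∈ l.tail.tail)).card := by
  rcases l with _ | ⟨u, t⟩
  · simp [headAdj]
  · rw [headAdj, ← List.toFinset_card_of_nodup (hnd u)]
    have hu : u ∉ adj u := fun h => G.loopless.irrefl u ((hadj u u).1 h)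
    have hsub : (adj u).toFinset ⊆ (adj u).toFinset.filter (fun w => w ∉ u :: t) ∪
        t.head?.toFinset ∪ (adj u).toFinset.filter (fun w => w ∈ (u :: t).tail.tail) := by
      intro w hw
      have hwu : w ≠ u := by
        rintro rfl
        exact hu (List.mem_toFinset.1 hw)
      by_cases hwt : w ∈ u :: t
      · rcases t with _ | ⟨y, b⟩
        · simp [hwu] at hwt
        · rcases List.mem_cons.1 ((List.mem_cons.1 hwt).resolve_left hwu) with rfl | h
          · simp
          · simp only [Finset.mem_union, Finset.mem_filter]
            exact Or.inr ⟨hw, h⟩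
      · simp only [Finset.mem_union, Finset.mem_filter]
        exact Or.inl (Or.inl ⟨hw, hwt⟩)
    refine (Finset.card_le_card hsub).trans ((Finset.card_union_le _ _).trans ?_)
    refine Nat.add_le_add_right ((Finset.card_union_le _ _).trans (Nat.add_le_add_left ?_ _)) _
    rcases t with _ | ⟨y, b⟩ <;> simp

/-- The pruning makes the rotation of walks along chords injective. -/
theorem PrunedWalk.not_append_rotate {G : SimpleGraph V} {adj : V → List V}
    (hadj : ∀ v w, w ∈ adj v ↔ G.Adj v w) {M M' : Finset V} {e e' z y y' : V}
    {c c' b b' X : List V}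
    (h : PrunedWalk G adj M (e :: c ++ z :: y :: b))
    (h' : PrunedWalk G adj M' (e' :: c' ++ z :: y' :: b')) (hy' : G.Adj y' e')
    (h2 : y :: b = X ++ e' :: y' :: b') : False := by
  rw [h2] at h
  -- In one walk `e'` follows `y'` and `z` comes later, in the other `z` follows `y'` and `e'` comes
  -- later. Hence each precedes the other in the list of `y'`, and they are equal.
  have i1 := h.later (e :: c ++ z :: X) e' y' b' (by simp) z (by simp)
  have i2 := h'.later (e' :: c') z y' b' rfl e' (by simp)
  have heq := (List.idxOf_inj ((hadj _ _).2 hy')).1 (le_antisymm i1 i2)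
  have := h'.nodup
  rw [← heq] at this
  simp at this

/-- Prepending the neighbour is injective and yields a self-avoiding walk again. -/
theorem sum_card_extensions_le [Finite V] (G : SimpleGraph V) (adj : V → List V)
    (hadj : ∀ v w, w ∈ adj v ↔ G.Adj v w) (v : V) (D : ℕ) (R : Finset (List V))
    (hR : ∀ l ∈ R, l ∈ revSaws G v D ∧ l.length ≤ D) :
    ∑ l ∈ R, ((headAdj adj l).toFinset.filter (fun w => w ∉ l)).card ≤
      (revSaws G v D).ncard := by
  rw [← Finset.card_sigma, Set.ncard_eq_toFinset_card _ (finite_revSaws G v D)]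
  refine Finset.card_le_card_of_injOn (fun x => x.2 :: x.1) ?_ ?_
  · rintro ⟨l, w⟩ hx
    simp only [Finset.coe_sigma, Set.mem_sigma_iff, Finset.mem_coe, Finset.mem_filter] at hx
    obtain ⟨⟨hnd, hch, hs, -⟩, hlen⟩ := hR l hx.1
    rw [Finset.mem_coe, Set.Finite.mem_toFinset]
    refine ⟨List.nodup_cons.2 ⟨hx.2.2, hnd⟩, ?_, hs.trans (List.suffix_cons _ _), by simpa⟩
    rcases l with _ | ⟨u, t⟩
    · simp
    · exact List.isChain_cons_cons.2 ⟨((hadj u w).1 (List.mem_toFinset.1 hx.2.1)).symm, hch⟩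
  · rintro ⟨l, w⟩ - ⟨l', w'⟩ - h
    simp only [List.cons.injEq] at h
    obtain ⟨rfl, rfl⟩ := h
    rfl

/-- Rotation along the chord keeps the start, the length and self-avoidance. In general a walk has
many preimages, one for each suitable place of the cut; among pruned walks the place is unique. -/
theorem sum_card_chords_le [Finite V] (G : SimpleGraph V) (adj : V → List V)
    (hadj : ∀ v w, w ∈ adj v ↔ G.Adj v w) (v : V) (D : ℕ) (R : Finset (List V))
    (hR : ∀ l ∈ R, l ∈ revSaws G v D ∧ ∃ M, PrunedWalk G adj M l) :
    ∑ l ∈ R, ((headAdj adj l).toFinset.filter (fun w => w ∈ l.tail.tail)).card ≤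
      (revSaws G v D).ncard := by
  rw [← Finset.card_sigma, Set.ncard_eq_toFinset_card _ (finite_revSaws G v D)]
  refine Finset.card_le_card_of_injOn (fun x => rotateAt x.1 x.2) ?_ ?_
  · rintro ⟨l, y⟩ hx
    simp only [Finset.coe_sigma, Set.mem_sigma_iff, Finset.mem_coe, Finset.mem_filter] at hx
    obtain ⟨hl, hy, hyt⟩ := hx
    obtain ⟨⟨hnd, hch, hs, hlen⟩, -⟩ := hR l hl
    obtain ⟨e, c, z, b, rfl, hrot⟩ := exists_chord_decomposition hnd hyt
    have hadj' : G.Adj e y := (hadj e y).1 (List.mem_toFinset.1 hy)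
    rw [Finset.mem_coe, Set.Finite.mem_toFinset]
    show rotateAt _ _ ∈ _
    rw [hrot]
    refine ⟨?_, ?_, ?_, ?_⟩
    · refine (List.Perm.nodup_iff ?_).2 hnd
      have p1 : (z :: (c.reverse ++ e :: y :: b)).Perm (z :: (c ++ e :: y :: b)) :=
        ((List.reverse_perm c).append_right _).cons z
      have p2 : (z :: (c ++ e :: y :: b)).Perm (z :: e :: (c ++ y :: b)) :=
        List.perm_middle.cons z
      have p3 : (z :: e :: (c ++ y :: b)).Perm (e :: z :: (c ++ y :: b)) := List.Perm.swap _ _ _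
      have p4 : (e :: z :: (c ++ y :: b)).Perm (e :: (c ++ z :: y :: b)) :=
        List.perm_middle.symm.cons e
      exact p1.trans (p2.trans (p3.trans p4))
    · have e1 : z :: (c.reverse ++ e :: y :: b) = (z :: c.reverse) ++ e :: y :: b := rfl
      rw [e1, List.isChain_append_cons_cons]
      obtain ⟨k1, -, k2⟩ := List.isChain_append_cons_cons.1 hch
      refine ⟨?_, hadj', k2⟩
      rw [← G.isChain_adj_reverse]
      simpa using k1
    · have hs' : [v] <:+ y :: b := by
        refine List.suffix_of_suffix_length_le hs ?_ (by simp)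
        exact ⟨e :: c ++ [z], by simp⟩
      exact hs'.trans ⟨z :: (c.reverse ++ [e]), by simp⟩
    · simp only [List.length_cons, List.length_append, List.length_reverse] at hlen ⊢
      omega
  · rintro ⟨l, y⟩ hx ⟨l', y'⟩ hx' h
    simp only [Finset.coe_sigma, Set.mem_sigma_iff, Finset.mem_coe, Finset.mem_filter] at hx hx'
    obtain ⟨hl, hy, hyt⟩ := hx
    obtain ⟨hl', hy', hyt'⟩ := hx'
    obtain ⟨-, M, hM⟩ := hR l hl
    obtain ⟨-, M', hM'⟩ := hR l' hl'
    obtain ⟨e, c, z, b, rfl, hrot⟩ := exists_chord_decomposition hM.nodup hyt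
    obtain ⟨e', c', z', b', rfl, hrot'⟩ := exists_chord_decomposition hM'.nodup hyt'
    have ha : G.Adj y e := ((hadj e y).1 (List.mem_toFinset.1 hy)).symm
    have ha' : G.Adj y' e' := ((hadj e' y').1 (List.mem_toFinset.1 hy')).symm
    replace h : rotateAt _ y = rotateAt _ y' := h
    rw [hrot, hrot', List.cons.injEq] at h
    obtain ⟨rfl, h⟩ := h
    -- Compare the places of the two cuts: if they agree, walk and chord are recovered; if not, one
    -- chord lies strictly beyond the other, against the pruning.
    rcases List.append_eq_append_iff.1 h with ⟨X, h1, h2⟩ | ⟨X, h1, h2⟩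
    · rcases X with _ | ⟨x, X⟩
      · simp only [List.append_nil, List.nil_append, List.cons.injEq, List.reverse_inj] at h1 h2
        obtain ⟨rfl, rfl, rfl⟩ := h2
        rw [h1]
      · simp only [List.cons_append, List.cons.injEq] at h2
        obtain ⟨rfl, h2⟩ := h2
        exact (hM.not_append_rotate hadj hM' ha' h2).elim
    · rcases X with _ | ⟨x, X⟩
      · simp only [List.append_nil, List.nil_append, List.cons.injEq, List.reverse_inj] at h1 h2
        obtain ⟨rfl, rfl, rfl⟩ := h2
        rw [h1]
      · simp only [List.cons_append, List.cons.injEq] at h2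
        obtain ⟨rfl, h2⟩ := h2
        exact (hM'.not_append_rotate hadj hM ha h2).elim

/-- The evaluation of a ratio takes a number of steps of the order of the number of self-avoiding
walks. -/
theorem nodeSteps_le [Finite V] (G : SimpleGraph V) (adj : V → List V)
    (hadj : ∀ v w, w ∈ adj v ↔ G.Adj v w) (hnd : ∀ v, (adj v).Nodup)
    (D : ℕ) (M : Finset V) (v : V) (hv : v ∈ M) :
    nodeSteps adj D M v ≤ 7 * ∑ i ∈ range (D + 1), sawCount G v i := by
  have hW := ncard_revSaws_le G v D
  have hsum := nodeSteps_eq_sum adj D M v []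
  rw [← List.sum_toFinset _ (nodup_prunedWalks adj D M v [])] at hsum
  set R := (prunedWalks adj D M v []).toFinset with hRdef
  have hR : ∀ l ∈ R, (∃ M, PrunedWalk G adj M l) ∧ l ∈ revSaws G v D ∧ l.length ≤ D := by
    intro l hl
    have hl := List.mem_toFinset.1 hl
    obtain ⟨M', hM'⟩ := (PrunedWalk.singleton G adj hv).of_mem_prunedWalks hadj hl
    obtain ⟨h1, h2⟩ := suffix_of_mem_prunedWalks adj hl
    simp only [List.length_nil, zero_add] at h2
    exact ⟨⟨M', hM'⟩, ⟨hM'.nodup, hM'.chain, h1, by omega⟩, h2⟩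
  have h1 := sum_card_extensions_le G adj hadj v D R (fun l hl => (hR l hl).2)
  have h2 := sum_card_chords_le G adj hadj v D R (fun l hl => ⟨(hR l hl).2.1, (hR l hl).1⟩)
  have h3 : R.card ≤ (revSaws G v D).ncard := by
    rw [Set.ncard_eq_toFinset_card _ (finite_revSaws G v D)]
    exact Finset.card_le_card (fun l hl => (Set.Finite.mem_toFinset _).2 (hR l hl).2.1)
  -- The constant is `7 = 2 + 2 + 3`: extensions and chords are counted twice each, and every node
  -- adds `2 * 1 + 1`.
  have h4 : ∑ l ∈ R, (2 * (headAdj adj l).length + 1) ≤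
      ∑ l ∈ R, (2 * (((headAdj adj l).toFinset.filter (fun w => w ∉ l)).card + 1 +
        ((headAdj adj l).toFinset.filter (fun w => w ∈ l.tail.tail)).card) + 1) :=
    Finset.sum_le_sum (fun l _ => by have := headAdj_length_le hadj hnd l; omega)
  simp only [Finset.sum_add_distrib, ← Finset.mul_sum, Finset.sum_const, smul_eq_mul,
    mul_one] at h4
  rw [Finset.sum_add_distrib, ← Finset.mul_sum, Finset.sum_const, smul_eq_mul, mul_one] at hsum
  omega

end RecursionTree

/-! ### The program and the effect of one round of its loop -/

section Program

open RAM

namespace RAM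

/-- The program `P`, started in `s`, halts within `B` time units with a memory satisfying `Q`. -/
def Runs (P : Cmd) (s : Memory) (B : ℕ) (Q : Memory → Prop) : Prop :=
  ∃ t s₁, Exec P s t s₁ ∧ t ≤ B ∧ Q s₁

theorem Runs.mono {P : Cmd} {s : Memory} {B B' : ℕ} {Q Q' : Memory → Prop} (h : Runs P s B Q)
    (hB : B ≤ B') (hQ : ∀ s₁, Q s₁ → Q' s₁) : Runs P s B' Q' := by
  obtain ⟨t, s₁, h1, h2, h3⟩ := h
  exact ⟨t, s₁, h1, h2.trans hB, hQ _ h3⟩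

theorem Runs.seq {P P' : Cmd} {s : Memory} {B B' : ℕ} {Q Q' : Memory → Prop}
    (h : Runs P s B Q) (h' : ∀ s₁, Q s₁ → Runs P' s₁ B' Q') : Runs (.seq P P') s (B + B') Q' := by
  obtain ⟨t, s₁, h1, h2, h3⟩ := h
  obtain ⟨t', s₂, h1', h2', h3'⟩ := h' s₁ h3
  exact ⟨t + t', s₂, .seq h1 h1', add_le_add h2 h2', h3'⟩

theorem Runs.skip {s : Memory} {Q : Memory → Prop} (h : Q s) : Runs .skip s 1 Q :=
  ⟨1, s, .skip s, le_rfl, h⟩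

theorem Runs.setNat {a : ℕ} {i e : NExp} {s : Memory} {Q : Memory → Prop}
    (h : Q (s.writeNat a (i.eval s) (e.eval s))) :
    Runs (.setNat a i e) s (i.cost + e.cost + 1) Q :=
  ⟨_, _, .setNat a i e s, le_rfl, h⟩

theorem Runs.setCplx {a : ℕ} {i : NExp} {x : CExp} {s : Memory} {Q : Memory → Prop}
    (hx : x.Defined s) (h : Q (s.writeCplx a (i.eval s) (x.eval s))) :
    Runs (.setCplx a i x) s (i.cost + x.cost + 1) Q :=
  ⟨_, _, .setCplx a i x s hx, le_rfl, h⟩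

theorem Runs.iteTrue {b : Test} {P P' : Cmd} {s : Memory} {B : ℕ} {Q : Memory → Prop}
    (hb : b.Holds s) (h : Runs P s B Q) : Runs (.ite b P P') s (b.cost + B) Q := by
  obtain ⟨t, s₁, h1, h2, h3⟩ := h
  exact ⟨_, s₁, .iteTrue hb h1, Nat.add_le_add_left h2 _, h3⟩

theorem Runs.iteFalse {b : Test} {P P' : Cmd} {s : Memory} {B : ℕ} {Q : Memory → Prop}
    (hb : ¬ b.Holds s) (h : Runs P' s B Q) : Runs (.ite b P P') s (b.cost + B) Q := by
  obtain ⟨t, s₁, h1, h2, h3⟩ := h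
  exact ⟨_, s₁, .iteFalse hb h1, Nat.add_le_add_left h2 _, h3⟩

theorem writeNat_nat (s : Memory) (a i k b j : ℕ) :
    (s.writeNat a i k).nat b j = if b = a ∧ j = i then k else s.nat b j := by
  simp only [Memory.writeNat, Function.update_apply]
  split_ifs <;> simp_all

theorem writeCplx_cplx (s : Memory) (a i : ℕ) (x : ℂ) (b j : ℕ) :
    (s.writeCplx a i x).cplx b j = if b = a ∧ j = i then x else s.cplx b j := by
  simp only [Memory.writeCplx, Function.update_apply]
  split_ifs <;> simp_all

theorem writeNat_cplx (s : Memory) (a i k : ℕ) : (s.writeNat a i k).cplx = s.cplx := rfl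

theorem writeCplx_nat (s : Memory) (a i : ℕ) (x : ℂ) : (s.writeCplx a i x).nat = s.nat := rfl

end RAM

/-! Registers of the program: cell `0` of array `4` is the height of the stack, and cells `1` and
`2` hold a degree and a neighbour. The arrays `5` and `6` and the complex array `2` hold the vertices,
the positions in the adjacency lists and the partial products of the stack frames. Cell `w` of array
`7` is `0` if the vertex `w` is present, and otherwise the height of the stack at its removal. -/

def heightExp : NExp := .get 4 (.lit 0)
def degreeExp : NExp := .get 4 (.lit 1)
def neighbourExp : NExp := .get 4 (.lit 2)
def vertexExp : NExp := .get 5 heightExp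
def pointerExp : NExp := .get 6 heightExp

/-- Load the degree of the top frame; the bottom frame has all vertices as neighbours. -/
def loadDegree : Cmd :=
  .ite (.eq heightExp (.lit 1)) (.setNat 4 (.lit 1) (.get 0 (.lit 0)))
    (.setNat 4 (.lit 1) (.get 1 vertexExp))

def loadNeighbour (i : NExp) : Cmd :=
  .ite (.eq heightExp (.lit 1)) (.setNat 4 (.lit 2) i)
    (.setNat 4 (.lit 2) (.get 3 (.add (.get 2 vertexExp) i)))

def advance : Cmd := .setNat 6 heightExp (.add pointerExp (.lit 1))

def pushFrame : Cmd :=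
  .seq (.setNat 4 (.lit 0) (.add heightExp (.lit 1)))
    (.seq (.setNat 5 heightExp neighbourExp)
      (.seq (.setNat 6 heightExp (.lit 0)) (.setCplx 2 heightExp (.lit 1))))

/-- The bottom frame has height `1`, so a frame of height `L + 1` has remaining depth `0`: it still
stamps its neighbours but pushes nothing, as their ratios are `1`. -/
def scanNeighbour : Cmd :=
  .seq (loadNeighbour pointerExp)
    (.seq advance
      (.ite (.eq (.get 7 neighbourExp) (.lit 0))
        (.seq (.setNat 7 neighbourExp heightExp)
          (.ite (.lt heightExp (.add (.get 0 (.lit 1)) (.lit 1))) pushFrame .skip))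
        .skip))

def restoreNeighbour : Cmd :=
  .seq (loadNeighbour (.sub pointerExp degreeExp))
    (.seq advance
      (.ite (.eq (.get 7 neighbourExp) heightExp) (.setNat 7 neighbourExp (.lit 0)) .skip))

/-- For the bottom frame this writes a meaningless value into cell `0`; the result stays in cell
`1`. -/
def popFrame : Cmd :=
  .seq (.setCplx 2 (.sub heightExp (.lit 1)) (.mul (.get 2 (.sub heightExp (.lit 1)))
      (.sub (.lit 1) (.div (.get 0 vertexExp) (.get 2 heightExp)))))
    (.setNat 4 (.lit 0) (.sub heightExp (.lit 1)))

/-- With `d` neighbours, a pointer below `d` means removing and descending, one from `d` to `2d - 1`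
means restoring, and `2d` means that the ratio is ready. -/
def loopBody : Cmd :=
  .seq loadDegree
    (.ite (.lt pointerExp degreeExp) scanNeighbour
      (.ite (.lt pointerExp (.add degreeExp degreeExp)) restoreNeighbour popFrame))

def mainLoop : Cmd := .while (.lt (.lit 0) heightExp) loopBody

/-- The product of the ratios of the computation trees of depth `L`. -/
def ratioProgram : Cmd :=
  .seq (.setNat 4 (.lit 0) (.lit 1))
    (.seq (.setCplx 2 (.lit 1) (.lit 1)) (.seq mainLoop (.setCplx 1 (.lit 0) (.get 2 (.lit 1)))))

structure Frame (n : ℕ) where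
  vertex : Fin n
  pointer : ℕ
  product : ℂ

variable {n : ℕ}

/-- The part of the memory that holds the input. -/
structure HoldsInput (adj : Fin n → List (Fin n)) (p : Fin n → ℂ) (L : ℕ) (s : Memory) :
    Prop where
  size : s.nat 0 0 = n
  depth : s.nat 0 1 = L
  degree : ∀ v : Fin n, s.nat 1 v = (adj v).length
  neighbour : ∀ (v : Fin n) (k : Fin (adj v).length),
    s.nat 3 (s.nat 2 v + k) = ((adj v).get k : ℕ)
  parameter : ∀ v : Fin n, s.cplx 0 v = p v

theorem HoldsInput.congr {adj : Fin n → List (Fin n)} {p : Fin n → ℂ} {L : ℕ} {s s' : Memory}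
    (h : HoldsInput adj p L s) (h1 : ∀ b < 4, ∀ i, s'.nat b i = s.nat b i)
    (h2 : ∀ i, s'.cplx 0 i = s.cplx 0 i) : HoldsInput adj p L s' where
  size := by rw [h1 0 (by norm_num)]; exact h.size
  depth := by rw [h1 0 (by norm_num)]; exact h.depth
  degree v := by rw [h1 1 (by norm_num)]; exact h.degree v
  neighbour v k := by rw [h1 3 (by norm_num), h1 2 (by norm_num)]; exact h.neighbour v k
  parameter v := by rw [h2]; exact h.parameter v

/-- The frames of the stack, from the top to the bottom, are stored in the memory. -/
def HoldsStack (s : Memory) : List (Frame n) → Prop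
  | [] => True
  | f :: rest => s.nat 5 (rest.length + 1) = f.vertex ∧ s.nat 6 (rest.length + 1) = f.pointer ∧
      s.cplx 2 (rest.length + 1) = f.product ∧ HoldsStack s rest

theorem HoldsStack.congr {s s' : Memory} {st : List (Frame n)} (h : HoldsStack s st)
    (h1 : ∀ j ≤ st.length, s'.nat 5 j = s.nat 5 j ∧ s'.nat 6 j = s.nat 6 j ∧
      (0 < j → s'.cplx 2 j = s.cplx 2 j)) :
    HoldsStack s' st := by
  induction st with
  | nil => trivial
  | cons f rest ih =>
    obtain ⟨k1, k2, k3, k4⟩ := h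
    obtain ⟨j1, j2, j3⟩ := h1 (rest.length + 1) (by simp)
    exact ⟨j1.trans k1, j2.trans k2, (j3 (Nat.succ_pos _)).trans k3,
      ih k4 (fun j hj => h1 j (hj.trans (by simp)))⟩

/-- The memory represents the configuration with stack `st` and removal stamps `m`. -/
structure Represents (adj : Fin n → List (Fin n)) (p : Fin n → ℂ) (L : ℕ) (s : Memory)
    (st : List (Frame n)) (m : Fin n → ℕ) : Prop where
  input : HoldsInput adj p L s
  height : s.nat 4 0 = st.length
  stack : HoldsStack s st
  stamps : ∀ w : Fin n, s.nat 7 w = m w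

/-- The neighbours to be visited from the vertex `v` of a frame on top of `rest`. -/
def frameList (adj : Fin n → List (Fin n)) (v : Fin n) (rest : List (Frame n)) : List (Fin n) :=
  if rest.length = 0 then List.finRange n else adj v

variable {adj : Fin n → List (Fin n)} {p : Fin n → ℂ} {L : ℕ} {s : Memory}
  {st rest : List (Frame n)} {m : Fin n → ℕ} {v w : Fin n} {i d : ℕ} {R : ℂ}

theorem Represents.writeRegister (h : Represents adj p L s st m) {j k : ℕ} (hj : j ≠ 0) :
    Represents adj p L (s.writeNat 4 j k) st m where
  input := h.input.congr (fun b hb i => by rw [writeNat_nat, if_neg (by omega)]) (fun _ => rfl)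
  height := by rw [writeNat_nat, if_neg (by omega), h.height]
  stack := h.stack.congr (fun j _ => by simp [writeNat_nat, writeNat_cplx])
  stamps w := by simp [writeNat_nat, h.stamps]

theorem Represents.writeStamp (h : Represents adj p L s st m) (w : Fin n) (k : ℕ) :
    Represents adj p L (s.writeNat 7 w k) st (Function.update m w k) where
  input := h.input.congr (fun b hb i => by rw [writeNat_nat, if_neg (by omega)]) (fun _ => rfl)
  height := by rw [writeNat_nat, if_neg (by omega), h.height]
  stack := h.stack.congr (fun j _ => by simp [writeNat_nat, writeNat_cplx])
  stamps w' := by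
    rw [writeNat_nat, Function.update_apply, h.stamps]
    simp [Fin.ext_iff]

theorem Represents.writePointer (h : Represents adj p L s (⟨v, i, R⟩ :: rest) m) (k : ℕ) :
    Represents adj p L (s.writeNat 6 (rest.length + 1) k) (⟨v, k, R⟩ :: rest) m where
  input := h.input.congr (fun b hb i => by rw [writeNat_nat, if_neg (by omega)]) (fun _ => rfl)
  height := by rw [writeNat_nat, if_neg (by omega), h.height]; simp
  stack := by
    obtain ⟨h1, -, h3, h4⟩ := h.stack
    refine ⟨by simpa [writeNat_nat] using h1, by simp [writeNat_nat],
      by simpa [writeNat_cplx] using h3, h4.congr (fun j hj => ?_)⟩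
    have : j ≠ rest.length + 1 := by omega
    simp [writeNat_nat, writeNat_cplx, this]
  stamps w := by simp [writeNat_nat, h.stamps]

theorem eval_heightExp (h : Represents adj p L s st m) : heightExp.eval s = st.length :=
  h.height

theorem eval_vertexExp (h : Represents adj p L s (⟨v, i, R⟩ :: rest) m) :
    vertexExp.eval s = v := by
  rw [vertexExp, NExp.eval, eval_heightExp h]
  exact h.stack.1

theorem eval_pointerExp (h : Represents adj p L s (⟨v, i, R⟩ :: rest) m) :
    pointerExp.eval s = i := by
  rw [pointerExp, NExp.eval, eval_heightExp h]
  exact h.stack.2.1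

theorem runs_loadDegree (h : Represents adj p L s (⟨v, i, R⟩ :: rest) m) :
    Runs loadDegree s 14 (fun s₁ => Represents adj p L s₁ (⟨v, i, R⟩ :: rest) m ∧
      degreeExp.eval s₁ = (frameList adj v rest).length) := by
  by_cases h0 : rest.length = 0
  · refine (Runs.iteTrue ?_ (Runs.setNat ⟨h.writeRegister one_ne_zero, ?_⟩)).mono (by decide)
      (fun _ => id)
    · rw [Test.Holds, eval_heightExp h]
      simp [NExp.eval, h0]
    · simp [degreeExp, NExp.eval, writeNat_nat, frameList, h0, h.input.size]
  · refine (Runs.iteFalse ?_ (Runs.setNat ⟨h.writeRegister one_ne_zero, ?_⟩)).mono (by decide)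
      (fun _ => id)
    · rw [Test.Holds, eval_heightExp h]
      simpa [NExp.eval] using h0
    · have he : (NExp.get 1 vertexExp).eval s = (adj v).length := by
        rw [NExp.eval, eval_vertexExp h, h.input.degree]
      rw [he]
      simp [degreeExp, NExp.eval, writeNat_nat, frameList, h0]

theorem runs_loadNeighbour (h : Represents adj p L s (⟨v, i, R⟩ :: rest) m) (e : NExp)
    (he : e.eval s < (frameList adj v rest).length) (hw : (frameList adj v rest)[e.eval s] = w) :
    Runs (loadNeighbour e) s (e.cost + 20) (fun s₁ =>
      Represents adj p L s₁ (⟨v, i, R⟩ :: rest) m ∧ neighbourExp.eval s₁ = w ∧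
      degreeExp.eval s₁ = degreeExp.eval s) := by
  subst hw
  have hdeg : ∀ k, degreeExp.eval (s.writeNat 4 2 k) = degreeExp.eval s := by
    intro k
    simp [degreeExp, NExp.eval, writeNat_nat]
  by_cases h0 : rest.length = 0
  · refine (Runs.iteTrue ?_ (Runs.setNat ⟨h.writeRegister two_ne_zero, ?_, hdeg _⟩)).mono ?_
      (fun _ => id)
    · rw [Test.Holds, eval_heightExp h]
      simp [NExp.eval, h0]
    · simp only [Test.cost, NExp.cost, heightExp]
      omega
    · simp [neighbourExp, NExp.eval, writeNat_nat, frameList, h0]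
  · refine (Runs.iteFalse ?_ (Runs.setNat ⟨h.writeRegister two_ne_zero, ?_, hdeg _⟩)).mono ?_
      (fun _ => id)
    · rw [Test.Holds, eval_heightExp h]
      simpa [NExp.eval] using h0
    · simp only [Test.cost, NExp.cost, heightExp, vertexExp]
      omega
    · simp only [frameList, h0, if_false] at he ⊢
      have := h.input.neighbour v ⟨_, he⟩
      simp only [List.get_eq_getElem] at this
      have he' : (NExp.get 3 (.add (.get 2 vertexExp) e)).eval s =
          (adj v)[e.eval s] := by
        rw [NExp.eval, NExp.eval, NExp.eval, eval_vertexExp h, this]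
      rw [he']
      simp [neighbourExp, NExp.eval, writeNat_nat]

theorem runs_advance (h : Represents adj p L s (⟨v, i, R⟩ :: rest) m) :
    Runs advance s 10 (fun s₁ => Represents adj p L s₁ (⟨v, i + 1, R⟩ :: rest) m ∧
      neighbourExp.eval s₁ = neighbourExp.eval s) := by
  refine (Runs.setNat ?_).mono (by decide) (fun _ => id)
  rw [eval_heightExp h, NExp.eval, eval_pointerExp h]
  exact ⟨h.writePointer _, by simp [neighbourExp, NExp.eval, writeNat_nat]⟩

theorem runs_setStamp (h : Represents adj p L s st m) (hw : neighbourExp.eval s = w) (e : NExp) :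
    Runs (.setNat 7 neighbourExp e) s (e.cost + 3) (fun s₁ =>
      Represents adj p L s₁ st (Function.update m w (e.eval s)) ∧
      neighbourExp.eval s₁ = neighbourExp.eval s) := by
  refine (Runs.setNat ?_).mono (by simp only [neighbourExp, NExp.cost]; omega) (fun _ => id)
  rw [hw]
  refine ⟨h.writeStamp w _, ?_⟩
  rw [← hw]
  simp [neighbourExp, NExp.eval, writeNat_nat]

theorem runs_pushFrame (h : Represents adj p L s st m) (hw : neighbourExp.eval s = w) :
    Runs pushFrame s 23 (fun s₁ => Represents adj p L s₁ (⟨w, 0, 1⟩ :: st) m) := by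
  have hh := h.height
  have hw' : s.nat 4 2 = w := hw
  refine ((Runs.setNat (Q := fun s₁ => s₁ = s.writeNat 4 0 (st.length + 1)) ?_).seq
    (B' := 17) ?_).mono (by decide) (fun _ => id)
  · simp [heightExp, NExp.eval, hh]
  rintro _ rfl
  refine ((Runs.setNat (Q := fun s₁ => s₁ = (s.writeNat 4 0 (st.length + 1)).writeNat 5
    (st.length + 1) w) ?_).seq (B' := 11) ?_).mono (by decide) (fun _ => id)
  · simp [heightExp, neighbourExp, NExp.eval, writeNat_nat, hw']
  rintro _ rfl
  refine ((Runs.setNat (Q := fun s₁ => s₁ = ((s.writeNat 4 0 (st.length + 1)).writeNat 5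
    (st.length + 1) w).writeNat 6 (st.length + 1) 0) ?_).seq (B' := 6) ?_).mono (by decide)
    (fun _ => id)
  · simp [heightExp, NExp.eval, writeNat_nat]
  rintro _ rfl
  refine (Runs.setCplx ?_ ?_).mono (by decide) (fun _ => id)
  · trivial
  simp only [heightExp, NExp.eval, CExp.eval, writeNat_nat]
  norm_num
  refine ⟨h.input.congr ?_ ?_, ?_, ?_, ?_⟩
  · intro b hb j
    have h4 : b ≠ 4 := by omega
    have h5 : b ≠ 5 := by omega
    have h6 : b ≠ 6 := by omega
    simp [writeCplx_nat, writeNat_nat, h4, h5, h6]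
  · intro j
    simp [writeCplx_cplx, writeNat_cplx]
  · simp [writeCplx_nat, writeNat_nat]
  · refine ⟨by simp [writeCplx_nat, writeNat_nat], by simp [writeCplx_nat, writeNat_nat],
      by simp [writeCplx_cplx], h.stack.congr (fun j hj => ?_)⟩
    have : j ≠ st.length + 1 := by omega
    simp [writeCplx_nat, writeCplx_cplx, writeNat_nat, writeNat_cplx, this]
  · intro w'
    simp [writeCplx_nat, writeNat_nat, h.stamps]

theorem runs_popFrame (h : Represents adj p L s (⟨v, i, R⟩ :: st) m) (hR : R ≠ 0) :
    Runs popFrame s 32 (fun s₁ => HoldsInput adj p L s₁ ∧ s₁.nat 4 0 = st.length ∧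
      s₁.nat 5 = s.nat 5 ∧ s₁.nat 6 = s.nat 6 ∧ s₁.nat 7 = s.nat 7 ∧
      s₁.cplx 2 = Function.update (s.cplx 2) st.length
        (s.cplx 2 st.length * (1 - p v / R))) := by
  have hh := eval_heightExp h
  have hv := eval_vertexExp h
  have hR' : s.cplx 2 (st.length + 1) = R := h.stack.2.2.1
  refine ((Runs.setCplx (Q := fun s₁ => s₁ = s.writeCplx 2 st.length
    (s.cplx 2 st.length * (1 - p v / R))) ?_ ?_).seq (B' := 6) ?_).mono (by decide) (fun _ => id)
  · refine ⟨trivial, trivial, trivial, trivial, ?_⟩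
    rw [CExp.eval, hh, List.length_cons, hR']
    exact hR
  · simp only [NExp.eval, CExp.eval, hh, hv, List.length_cons, hR', h.input.parameter,
      Nat.add_sub_cancel, Int.cast_one]
  rintro _ rfl
  refine (Runs.setNat ?_).mono (by decide) (fun _ => id)
  have hh' : heightExp.eval (s.writeCplx 2 st.length (s.cplx 2 st.length * (1 - p v / R))) =
      st.length + 1 := hh
  simp only [NExp.eval, hh', Nat.add_sub_cancel]
  refine ⟨h.input.congr ?_ ?_, by simp [writeNat_nat], ?_, ?_, ?_, ?_⟩
  · intro b hb j
    have h4 : b ≠ 4 := by omega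
    simp [writeCplx_nat, writeNat_nat, h4]
  · intro j
    simp [writeCplx_cplx, writeNat_cplx]
  · ext j; simp [writeCplx_nat, writeNat_nat]
  · ext j; simp [writeCplx_nat, writeNat_nat]
  · ext j; simp [writeCplx_nat, writeNat_nat]
  · ext j
    simp [writeCplx_cplx, writeNat_cplx, Function.update_apply]

/-- The memory after one round of the main loop. -/
theorem runs_loopBody_scan (h : Represents adj p L s (⟨v, i, R⟩ :: rest) m)
    (hi : i < (frameList adj v rest).length) (hw : (frameList adj v rest)[i] = w) :
    Runs loopBody s 150 (fun s₁ =>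
      if m w = 0 then
        if rest.length < L then
          Represents adj p L s₁ (⟨w, 0, 1⟩ :: ⟨v, i + 1, R⟩ :: rest)
            (Function.update m w (rest.length + 1))
        else Represents adj p L s₁ (⟨v, i + 1, R⟩ :: rest)
            (Function.update m w (rest.length + 1))
      else Represents adj p L s₁ (⟨v, i + 1, R⟩ :: rest) m) := by
  refine ((runs_loadDegree h).seq (B' := 136) ?_).mono (by decide) (fun _ => id)
  rintro s₁ ⟨h1, hd⟩
  refine (Runs.iteTrue (B := 129) ?_ ?_).mono (by decide) (fun _ => id)
  · rw [Test.Holds, eval_pointerExp h1, hd]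
    exact hi
  have hp := eval_pointerExp h1
  refine ((runs_loadNeighbour h1 pointerExp (w := w) (by rw [hp]; exact hi)
    (by simp only [hp, hw])).seq (B' := 100) ?_).mono (by decide) (fun _ => id)
  rintro s₂ ⟨h2, hw2, -⟩
  refine ((runs_advance h2).seq (B' := 90) ?_).mono (by decide) (fun _ => id)
  rintro s₃ ⟨h3, hw3⟩
  rw [hw2] at hw3
  have hm : s₃.nat 7 (neighbourExp.eval s₃) = m w := by
    rw [hw3]
    exact h3.stamps w
  split_ifs with hmw hL
  · refine (Runs.iteTrue (B := 70) (by simpa [Test.Holds, NExp.eval, hm] using hmw) ?_).mono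
      (by decide) (fun _ => id)
    refine ((runs_setStamp h3 hw3 heightExp).seq (B' := 60) ?_).mono (by decide) (fun _ => id)
    rintro s₄ ⟨h4, hw4⟩
    rw [eval_heightExp h3] at h4
    refine (Runs.iteTrue ?_ (runs_pushFrame h4 (hw4.trans hw3))).mono (by decide) (fun _ => id)
    rw [Test.Holds, eval_heightExp h4]
    simpa [NExp.eval, h4.input.depth] using hL
  · refine (Runs.iteTrue (B := 70) (by simpa [Test.Holds, NExp.eval, hm] using hmw) ?_).mono
      (by decide) (fun _ => id)
    refine ((runs_setStamp h3 hw3 heightExp).seq (B' := 60) ?_).mono (by decide) (fun _ => id)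
    rintro s₄ ⟨h4, hw4⟩
    rw [eval_heightExp h3] at h4
    refine (Runs.iteFalse ?_ (Runs.skip h4)).mono (by decide) (fun _ => id)
    rw [Test.Holds, eval_heightExp h4]
    simpa [NExp.eval, h4.input.depth] using hL
  · exact (Runs.iteFalse (by simpa [Test.Holds, NExp.eval, hm] using hmw) (Runs.skip h3)).mono
      (by decide) (fun _ => id)

theorem runs_loopBody_restore
    (h : Represents adj p L s (⟨v, (frameList adj v rest).length + i, R⟩ :: rest) m)
    (hi : i < (frameList adj v rest).length) (hw : (frameList adj v rest)[i] = w) :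
    Runs loopBody s 150 (fun s₁ =>
      Represents adj p L s₁ (⟨v, (frameList adj v rest).length + (i + 1), R⟩ :: rest)
        (if m w = rest.length + 1 then Function.update m w 0 else m)) := by
  refine ((runs_loadDegree h).seq (B' := 136) ?_).mono (by decide) (fun _ => id)
  rintro s₁ ⟨h1, hd⟩
  refine (Runs.iteFalse (B := 129) ?_ ?_).mono (by decide) (fun _ => id)
  · rw [Test.Holds, eval_pointerExp h1, hd]
    omega
  refine (Runs.iteTrue (B := 110) ?_ ?_).mono (by decide) (fun _ => id)
  · rw [Test.Holds, eval_pointerExp h1, NExp.eval, hd]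
    omega
  have hp : (NExp.sub pointerExp degreeExp).eval s₁ = i := by
    rw [NExp.eval, eval_pointerExp h1, hd]
    omega
  refine ((runs_loadNeighbour h1 (.sub pointerExp degreeExp) (w := w) (by rw [hp]; exact hi)
    (by simp only [hp, hw])).seq (B' := 70) ?_).mono (by decide) (fun _ => id)
  rintro s₂ ⟨h2, hw2, -⟩
  refine ((runs_advance h2).seq (B' := 60) ?_).mono (by decide) (fun _ => id)
  rintro s₃ ⟨h3, hw3⟩
  rw [hw2] at hw3
  have hm : s₃.nat 7 (neighbourExp.eval s₃) = m w := by
    rw [hw3]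
    exact h3.stamps w
  split_ifs with hmw
  · refine (Runs.iteTrue ?_ (runs_setStamp h3 hw3 (.lit 0))).mono (by decide) (fun _ h => h.1)
    rw [Test.Holds, eval_heightExp h3, NExp.eval, hm, hmw]
    simp
  · refine (Runs.iteFalse ?_ (Runs.skip h3)).mono (by decide) (fun _ => id)
    rw [Test.Holds, eval_heightExp h3, NExp.eval, hm]
    simpa using hmw

theorem runs_loopBody_pop
    (h : Represents adj p L s (⟨v, (frameList adj v st).length + (frameList adj v st).length, R⟩
      :: st) m) (hR : R ≠ 0) :
    Runs loopBody s 150 (fun s₁ => s₁.nat 4 0 = st.length ∧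
      (∀ u i R' rest, st = ⟨u, i, R'⟩ :: rest →
        Represents adj p L s₁ (⟨u, i, R' * (1 - p v / R)⟩ :: rest) m) ∧
      (st = [] → s₁.cplx 2 1 = R)) := by
  refine ((runs_loadDegree h).seq (B' := 136) ?_).mono (by decide) (fun _ => id)
  rintro s₁ ⟨h1, hd⟩
  refine (Runs.iteFalse (B := 129) ?_ ?_).mono (by decide) (fun _ => id)
  · rw [Test.Holds, eval_pointerExp h1, hd]
    omega
  refine (Runs.iteFalse (B := 110) ?_ ?_).mono (by decide) (fun _ => id)
  · rw [Test.Holds, eval_pointerExp h1, NExp.eval, hd]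
    omega
  refine (runs_popFrame h1 hR).mono (by decide) ?_
  rintro s₂ ⟨k1, k2, k3, k4, k5, k6⟩
  refine ⟨k2, ?_, ?_⟩
  · rintro u i R' rest rfl
    obtain ⟨-, -, -, j1, j2, j3, j4⟩ := h1.stack
    refine ⟨k1, k2, ⟨by rw [k3]; exact j1, by rw [k4]; exact j2, ?_, ?_⟩, ?_⟩
    · rw [k6, List.length_cons, Function.update_self, j3]
    · refine j4.congr (fun j hj => ⟨by rw [k3], by rw [k4], fun _ => ?_⟩)
      rw [k6, Function.update_of_ne]
      simp
      omega
    · intro w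
      rw [k5]
      exact h1.stamps w
  · rintro rfl
    rw [k6, List.length_nil, Function.update_of_ne one_ne_zero]
    exact h1.stack.2.2.1

end Program

/-! ### The main loop carries out the recursion -/

section Simulation

open RAM

variable {n : ℕ}

/-- The main loop leads from one configuration to another one within `c` rounds. -/
def Reaches (adj : Fin n → List (Fin n)) (p : Fin n → ℂ) (L : ℕ) (st : List (Frame n))
    (m : Fin n → ℕ) (c : ℕ) (st' : List (Frame n)) (m' : Fin n → ℕ) : Prop :=
  ∀ s, Represents adj p L s st m → ∃ t s', t ≤ 154 * c ∧ Represents adj p L s' st' m' ∧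
    ∀ t' s'', Exec mainLoop s' t' s'' → Exec mainLoop s (t + t') s''

variable {adj : Fin n → List (Fin n)} {p : Fin n → ℂ} {L : ℕ} {m m' m'' : Fin n → ℕ}
  {st st' st'' rest : List (Frame n)} {c c' : ℕ} {v w : Fin n} {i : ℕ} {R : ℂ}

theorem Reaches.refl : Reaches adj p L st m 0 st m :=
  fun s hs => ⟨0, s, by simp, hs, fun t' s'' h => by simpa using h⟩

theorem Reaches.trans (h : Reaches adj p L st m c st' m')
    (h' : Reaches adj p L st' m' c' st'' m'') : Reaches adj p L st m (c + c') st'' m'' := by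
  intro s hs
  obtain ⟨t, s₁, h1, h2, h3⟩ := h s hs
  obtain ⟨t', s₂, h1', h2', h3'⟩ := h' s₁ h2
  refine ⟨t + t', s₂, by omega, h2', fun u s'' hu => ?_⟩
  rw [add_assoc]
  exact h3 _ _ (h3' _ _ hu)

theorem Reaches.of_runs (hst : st ≠ [])
    (h : ∀ s, Represents adj p L s st m →
      Runs loopBody s 150 (fun s₁ => Represents adj p L s₁ st' m')) :
    Reaches adj p L st m 1 st' m' := by
  intro s hs
  obtain ⟨t, s₁, h1, h2, h3⟩ := h s hs
  -- A round costs at most `150` for the body and `4` for the loop test.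
  refine ⟨4 + t, s₁, by omega, h3, fun t' s'' h' => ?_⟩
  refine Exec.whileTrue (b := .lt (.lit 0) heightExp) ?_ h1 h'
  rw [Test.Holds, eval_heightExp hs]
  exact List.length_pos_iff.2 hst

/-- The removed vertices. -/
def removed (m : Fin n → ℕ) : Finset (Fin n) := Finset.univ.filter (fun w => m w ≠ 0)

/-- Stamp the vertices of `ws` that are present. -/
def stampAll (m : Fin n → ℕ) (ws : List (Fin n)) (k : ℕ) : Fin n → ℕ :=
  fun w => if m w = 0 ∧ w ∈ ws then k else m w

/-- Restore the vertices of `ws` with stamp `k`. -/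
def restoreAll (m : Fin n → ℕ) (ws : List (Fin n)) (k : ℕ) : Fin n → ℕ :=
  fun w => if w ∈ ws ∧ m w = k then 0 else m w

theorem removed_update (m : Fin n → ℕ) (w : Fin n) (k : ℕ) :
    removed (Function.update m w (k + 1)) = insert w (removed m) := by
  ext x
  by_cases h : x = w <;> simp [removed, Function.update_apply, h]

theorem stampAll_cons_of_ne (m : Fin n → ℕ) (w : Fin n) (ws : List (Fin n)) (k : ℕ)
    (hw : m w ≠ 0) : stampAll m (w :: ws) k = stampAll m ws k := by
  ext x
  by_cases h : x = w <;> simp [stampAll, h, hw]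

theorem stampAll_update (m : Fin n → ℕ) (w : Fin n) (ws : List (Fin n)) (k : ℕ) (hw : m w = 0) :
    stampAll (Function.update m w (k + 1)) ws (k + 1) = stampAll m (w :: ws) (k + 1) := by
  ext x
  by_cases h : x = w <;> simp [stampAll, h, hw]

theorem restoreAll_cons (m : Fin n → ℕ) (w : Fin n) (ws : List (Fin n)) (k : ℕ) :
    restoreAll (if m w = k + 1 then Function.update m w 0 else m) ws (k + 1) =
      restoreAll m (w :: ws) (k + 1) := by
  ext x
  by_cases h : x = w
  · subst h
    by_cases h' : m x = k + 1 <;> simp [restoreAll, h']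
  · by_cases h' : m w = k + 1 <;> simp [restoreAll, h, h']

/-- The stamp `k + 1` is fresh, so it marks precisely the removals to be undone. -/
theorem restoreAll_stampAll (m : Fin n → ℕ) (ws : List (Fin n)) (k : ℕ) (hm : ∀ w, m w ≤ k) :
    restoreAll (stampAll m ws (k + 1)) ws (k + 1) = m := by
  ext x
  have hx := hm x
  have : m x ≠ k + 1 := by omega
  by_cases h : x ∈ ws <;> by_cases h0 : m x = 0 <;> simp [restoreAll, stampAll, h, h0, this]

/-- The hypothesis `hnode` stands for the recursive calls, so the lemma serves both the induction on
the depth and the bottom frame. It is vacuous for `D = 0`. -/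
theorem reaches_scan (D : ℕ)
    (hnode : ∀ (k : ℕ), D = k + 1 → ∀ (rest : List (Frame n)) (u : Fin n) (i : ℕ) (R : ℂ)
      (m : Fin n → ℕ) (v : Fin n), rest.length + D = L → (∀ w, m w ≤ rest.length + 1) →
      m v ≠ 0 → Reaches adj p L (⟨v, 0, 1⟩ :: ⟨u, i, R⟩ :: rest) m
        (nodeSteps adj D (removed m) v)
        (⟨u, i, R * ratio adj p D (removed m) v⟩ :: rest) m)
    (rest : List (Frame n)) (v : Fin n) (hD : rest.length + D = L) (ws pre : List (Fin n))
    (hws : frameList adj v rest = pre ++ ws) (R : ℂ) (m : Fin n → ℕ)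
    (hm : ∀ w, m w ≤ rest.length + 1) :
    Reaches adj p L (⟨v, pre.length, R⟩ :: rest) m
      (ws.length + ((kids (removed m) ws).map (fun c => nodeSteps adj D c.1 c.2)).sum)
      (⟨v, (frameList adj v rest).length,
        R * ((kids (removed m) ws).map (fun c => ratio adj p D c.1 c.2)).prod⟩ :: rest)
      (stampAll m ws (rest.length + 1)) := by
  induction ws generalizing pre R m with
  | nil =>
    have e1 : (frameList adj v rest).length = pre.length := by simp [hws]
    have e2 : stampAll m [] (rest.length + 1) = m := by
      ext w
      simp [stampAll]
    rw [e1, e2]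
    simpa [kids] using Reaches.refl
  | cons w ws ih =>
    have hlt : pre.length < (frameList adj v rest).length := by simp [hws]
    have hget : (frameList adj v rest)[pre.length] = w := by simp [hws]
    have hstep := fun s hs => runs_loopBody_scan (adj := adj) (p := p) (L := L) (s := s)
      (rest := rest) (m := m) (v := v) (w := w) (R := R) hs hlt hget
    have hpre : (pre ++ [w]).length = pre.length + 1 := by simp
    have hws' : frameList adj v rest = (pre ++ [w]) ++ ws := by simp [hws]
    by_cases hw : m w = 0
    · have hwm : w ∉ removed m := by simp [removed, hw]
      have hm1 : ∀ x, Function.update m w (rest.length + 1) x ≤ rest.length + 1 := by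
        intro x
        rw [Function.update_apply]
        split_ifs
        · exact le_rfl
        · exact hm x
      have hkids : kids (removed m) (w :: ws) = (insert w (removed m), w) ::
          kids (insert w (removed m)) ws := by rw [kids, if_neg hwm]
      have key : Reaches adj p L (⟨v, pre.length, R⟩ :: rest) m
          (1 + nodeSteps adj D (insert w (removed m)) w)
          (⟨v, pre.length + 1, R * ratio adj p D (insert w (removed m)) w⟩ :: rest)
          (Function.update m w (rest.length + 1)) := by
        rcases D with _ | k
        · rw [nodeSteps, ratio, mul_one]
          refine Reaches.of_runs (by simp) (fun s hs => ?_)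
          simpa only [if_pos hw, if_neg (show ¬ rest.length < L by omega)] using hstep s hs
        · have h1 : Reaches adj p L (⟨v, pre.length, R⟩ :: rest) m 1
              (⟨w, 0, 1⟩ :: ⟨v, pre.length + 1, R⟩ :: rest)
              (Function.update m w (rest.length + 1)) := by
            refine Reaches.of_runs (by simp) (fun s hs => ?_)
            simpa only [if_pos hw, if_pos (show rest.length < L by omega)] using hstep s hs
          have h2 := hnode k rfl rest v (pre.length + 1) R _ w hD hm1 (by simp)
          rw [removed_update] at h2
          exact h1.trans h2
      have h3 := ih (pre ++ [w]) hws' (R * ratio adj p D (insert w (removed m)) w) _ hm1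
      rw [removed_update, hpre, stampAll_update m w ws _ hw] at h3
      have h4 := key.trans h3
      rw [hkids, List.map_cons, List.map_cons, List.prod_cons, List.sum_cons, ← mul_assoc,
        List.length_cons]
      convert h4 using 1
      dsimp only
      omega
    · have hwm : w ∈ removed m := by simp [removed, hw]
      have hkids : kids (removed m) (w :: ws) = kids (removed m) ws := by rw [kids, if_pos hwm]
      have h1 : Reaches adj p L (⟨v, pre.length, R⟩ :: rest) m 1
          (⟨v, pre.length + 1, R⟩ :: rest) m := by
        refine Reaches.of_runs (by simp) (fun s hs => ?_)
        simpa only [if_neg hw] using hstep s hs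
      have h3 := ih (pre ++ [w]) hws' R m hm
      rw [hpre] at h3
      have h4 := h1.trans h3
      rw [hkids, stampAll_cons_of_ne m w ws _ hw, List.length_cons]
      convert h4 using 1
      omega

theorem reaches_restore (rest : List (Frame n)) (v : Fin n) (ws pre : List (Fin n))
    (hws : frameList adj v rest = pre ++ ws) (R : ℂ) (m : Fin n → ℕ) :
    Reaches adj p L (⟨v, (frameList adj v rest).length + pre.length, R⟩ :: rest) m ws.length
      (⟨v, (frameList adj v rest).length + (frameList adj v rest).length, R⟩ :: rest)
      (restoreAll m ws (rest.length + 1)) := by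
  induction ws generalizing pre m with
  | nil =>
    have e1 : (frameList adj v rest).length = pre.length := by simp [hws]
    have e2 : restoreAll m [] (rest.length + 1) = m := by
      ext w
      simp [restoreAll]
    rw [e1, e2]
    exact Reaches.refl
  | cons w ws ih =>
    have hlt : pre.length < (frameList adj v rest).length := by simp [hws]
    have hget : (frameList adj v rest)[pre.length] = w := by simp [hws]
    have h1 := Reaches.of_runs (by simp) (fun s hs => runs_loopBody_restore (adj := adj) (p := p)
      (L := L) (s := s) (rest := rest) (m := m) (v := v) (w := w) (R := R) hs hlt hget)
    have h2 := ih (pre ++ [w]) (by simp [hws])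
      (if m w = rest.length + 1 then Function.update m w 0 else m)
    rw [List.length_append, List.length_singleton, restoreAll_cons] at h2
    have h3 := h1.trans h2
    rwa [add_comm 1] at h3

theorem reaches_scan_restore (D : ℕ)
    (hnode : ∀ (k : ℕ), D = k + 1 → ∀ (rest : List (Frame n)) (u : Fin n) (i : ℕ) (R : ℂ)
      (m : Fin n → ℕ) (v : Fin n), rest.length + D = L → (∀ w, m w ≤ rest.length + 1) →
      m v ≠ 0 → Reaches adj p L (⟨v, 0, 1⟩ :: ⟨u, i, R⟩ :: rest) m
        (nodeSteps adj D (removed m) v)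
        (⟨u, i, R * ratio adj p D (removed m) v⟩ :: rest) m)
    (rest : List (Frame n)) (v : Fin n) (hD : rest.length + D = L) (m : Fin n → ℕ)
    (hm : ∀ w, m w ≤ rest.length) :
    Reaches adj p L (⟨v, 0, 1⟩ :: rest) m
      (2 * (frameList adj v rest).length +
        ((kids (removed m) (frameList adj v rest)).map (fun c => nodeSteps adj D c.1 c.2)).sum)
      (⟨v, (frameList adj v rest).length + (frameList adj v rest).length,
        ((kids (removed m) (frameList adj v rest)).map
          (fun c => ratio adj p D c.1 c.2)).prod⟩ :: rest) m := by
  have h1 := reaches_scan D hnode rest v hD (frameList adj v rest) [] rfl 1 m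
    (fun w => (hm w).trans (Nat.le_succ _))
  have h2 := reaches_restore (adj := adj) (p := p) (L := L) rest v (frameList adj v rest) [] rfl
    ((1 : ℂ) * ((kids (removed m) (frameList adj v rest)).map
      (fun c => ratio adj p D c.1 c.2)).prod)
    (stampAll m (frameList adj v rest) (rest.length + 1))
  rw [restoreAll_stampAll m _ _ hm] at h2
  have h3 := h1.trans h2
  rw [one_mul] at h3
  convert h3 using 1
  · rfl
  · omega

theorem prod_ratio_ne_zero (hne : ∀ D M v, v ∈ M → ratio adj p D M v ≠ 0) (D : ℕ)
    (M : Finset (Fin n)) (ws : List (Fin n)) :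
    ((kids M ws).map (fun c => ratio adj p D c.1 c.2)).prod ≠ 0 := by
  refine List.prod_ne_zero (fun h => ?_)
  obtain ⟨c, hc, h0⟩ := List.mem_map.1 h
  exact hne _ _ _ (snd_mem_fst_of_mem_kids hc).1 h0

theorem reaches_node (hne : ∀ D M v, v ∈ M → ratio adj p D M v ≠ 0) (k : ℕ)
    (rest : List (Frame n)) (u : Fin n) (i : ℕ) (R : ℂ) (m : Fin n → ℕ) (v : Fin n)
    (hD : rest.length + (k + 1) = L) (hm : ∀ w, m w ≤ rest.length + 1) :
    Reaches adj p L (⟨v, 0, 1⟩ :: ⟨u, i, R⟩ :: rest) m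
      (nodeSteps adj (k + 1) (removed m) v)
      (⟨u, i, R * ratio adj p (k + 1) (removed m) v⟩ :: rest) m := by
  induction k generalizing rest u i R m v with
  | zero =>
    have h1 := reaches_scan_restore (adj := adj) (p := p) (L := L) 0
      (fun k hk => by omega) (⟨u, i, R⟩ :: rest) v (by simpa using hD) m hm
    have h2 := Reaches.of_runs (by simp) (fun s hs => (runs_loopBody_pop (adj := adj) (p := p)
      (L := L) (s := s) (m := m) (v := v) (st := ⟨u, i, R⟩ :: rest) hs
      (prod_ratio_ne_zero hne 0 (removed m) (frameList adj v (⟨u, i, R⟩ :: rest)))).mono le_rfl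
      (fun s₁ h => h.2.1 u i R rest rfl))
    have h3 := h1.trans h2
    have e : frameList adj v (⟨u, i, R⟩ :: rest) = adj v := by simp [frameList]
    rw [e] at h3
    rw [nodeSteps, ratio]
    convert h3 using 1
    omega
  | succ k ih =>
    have h1 := reaches_scan_restore (adj := adj) (p := p) (L := L) (k + 1)
      (fun k' hk rest u i R m v hD hm _ => ih rest u i R m v hD hm)
      (⟨u, i, R⟩ :: rest) v (by rw [List.length_cons]; omega) m hm
    have h2 := Reaches.of_runs (by simp) (fun s hs => (runs_loopBody_pop (adj := adj) (p := p)
      (L := L) (s := s) (m := m) (v := v) (st := ⟨u, i, R⟩ :: rest) hs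
      (prod_ratio_ne_zero hne (k + 1) (removed m)
        (frameList adj v (⟨u, i, R⟩ :: rest)))).mono le_rfl (fun s₁ h => h.2.1 u i R rest rfl))
    have h3 := h1.trans h2
    have e : frameList adj v (⟨u, i, R⟩ :: rest) = adj v := by simp [frameList]
    rw [e] at h3
    rw [nodeSteps, ratio]
    convert h3 using 1
    omega

/-- Running time and output of the program. -/
theorem exec_ratioProgram (hn : 0 < n) (hne : ∀ D M v, v ∈ M → ratio adj p D M v ≠ 0)
    {s : Memory} (hs : IsInput n adj p L s) :
    ∃ t s₁, Exec ratioProgram s t s₁ ∧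
      t ≤ 154 * (2 * n + 1 + ((kids ∅ (List.finRange n)).map
        (fun c => nodeSteps adj L c.1 c.2)).sum) + 20 ∧
      output s₁ = ((kids ∅ (List.finRange n)).map (fun c => ratio adj p L c.1 c.2)).prod := by
  -- The vertex of the bottom frame is `0` only because the work space is initially zero; the frame
  -- runs through all vertices instead of a neighbourhood.
  set v₀ : Fin n := ⟨0, hn⟩ with hv₀
  set s₁ := s.writeNat 4 0 1 with hs₁
  set s₂ := s₁.writeCplx 2 1 1 with hs₂
  have x1 : Exec (.setNat 4 (.lit 0) (.lit 1)) s 3 s₁ := .setNat 4 (.lit 0) (.lit 1) s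
  have x2 : Exec (.setCplx 2 (.lit 1) (.lit 1)) s₁ 3 s₂ := by
    have := Exec.setCplx 2 (.lit 1) (.lit 1) s₁ trivial
    simpa [NExp.eval, CExp.eval, NExp.cost, CExp.cost] using this
  have hrep : Represents adj p L s₂ [⟨v₀, 0, 1⟩] (fun _ => 0) := by
    refine ⟨?_, ?_, ?_, ?_⟩
    · refine HoldsInput.congr (s := s) ⟨hs.size, hs.depth, hs.degree, hs.neighbour, hs.parameter⟩
        ?_ ?_
      · intro b hb j
        have h4 : b ≠ 4 := by omega
        simp [hs₂, hs₁, writeCplx_nat, writeNat_nat, h4]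
      · intro j
        simp [hs₂, hs₁, writeCplx_cplx, writeNat_cplx]
    · simp [hs₂, hs₁, writeCplx_nat, writeNat_nat]
    · refine ⟨?_, ?_, ?_, trivial⟩
      · simp [hs₂, hs₁, writeCplx_nat, writeNat_nat, hs.natZero, hv₀]
      · simp [hs₂, hs₁, writeCplx_nat, writeNat_nat, hs.natZero]
      · simp [hs₂, writeCplx_cplx]
    · intro w
      simp [hs₂, hs₁, writeCplx_nat, writeNat_nat, hs.natZero]
  have hreach := reaches_scan_restore (adj := adj) (p := p) (L := L) L
    (fun k hk rest u i R m v hD hm _ => by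
      subst hk
      exact reaches_node hne k rest u i R m v hD hm)
    [] v₀ (by simp) (fun _ => 0) (fun _ => le_rfl)
  have e1 : frameList adj v₀ [] = List.finRange n := by simp [frameList]
  have e2 : removed (fun _ : Fin n => 0) = ∅ := by simp [removed]
  obtain ⟨t, s₃, ht, hrep₃, hexec⟩ := hreach s₂ hrep
  -- The last pop is treated by hand, since it leaves no frame to receive the ratio.
  obtain ⟨t', s₄, hx, ht', hheight, -, hres⟩ := runs_loopBody_pop hrep₃
    (prod_ratio_ne_zero hne L (removed (fun _ : Fin n => 0)) (frameList adj v₀ []))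
  rw [e1, e2, List.length_finRange] at ht
  have hres := hres rfl
  rw [e1, e2] at hres
  have hloop₃ : Exec mainLoop s₃ (4 + t' + 4) s₄ := by
    refine Exec.whileTrue (b := .lt (.lit 0) heightExp) ?_ hx
      (Exec.whileFalse (b := .lt (.lit 0) heightExp) ?_)
    · rw [Test.Holds, eval_heightExp hrep₃]
      simp [NExp.eval]
    · have : heightExp.eval s₄ = 0 := hheight
      rw [Test.Holds, this]
      simp
  have x4 : Exec (.setCplx 1 (.lit 0) (.get 2 (.lit 1))) s₄ 4 (s₄.writeCplx 1 0 (s₄.cplx 2 1)) :=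
    Exec.setCplx 1 (.lit 0) (.get 2 (.lit 1)) s₄ trivial
  refine ⟨_, _, x1.seq (x2.seq ((hexec _ _ hloop₃).seq x4)), by omega, ?_⟩
  rw [output, writeCplx_cplx, if_pos ⟨rfl, rfl⟩, hres]

end Simulation

/-! ### Running time in terms of the connective constant -/

/-- The trivial walk forces `c * Δ ^ ℓ ≥ 1` for all large `ℓ`. Odd powers exclude `Δ ≤ 0`, and
powers tending to zero exclude `0 < Δ < 1`. This lets lower-order terms and the rounding of `ℓ` be
absorbed. -/
theorem one_le_of_connectiveConstantAtMost {𝒢 : Set FinGraph} {Δ a c : ℝ}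
    (h : ConnectiveConstantAtMost 𝒢 Δ a c) {n : ℕ} {G : SimpleGraph (Fin n)} (hn : 0 < n)
    (hG : (⟨n, G⟩ : FinGraph) ∈ 𝒢) : 1 ≤ Δ ∧ ∀ ℓ : ℕ, a * Real.log n ≤ ℓ → 1 ≤ c * Δ ^ ℓ := by
  obtain ⟨ha, hc, h⟩ := h
  have hone : ∀ ℓ : ℕ, a * Real.log n ≤ ℓ → 1 ≤ c * Δ ^ ℓ := by
    intro ℓ hℓ
    refine le_trans ?_ (h n G hG ⟨0, hn⟩ ℓ hℓ)
    have h1 := ncard_revSaws_le G ⟨0, hn⟩ ℓ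
    have h2 : 1 ≤ (revSaws G ⟨0, hn⟩ ℓ).ncard := by
      rw [Nat.one_le_iff_ne_zero, ← Nat.pos_iff_ne_zero, Set.ncard_pos (finite_revSaws _ _ _)]
      exact ⟨[⟨0, hn⟩], by simp, by simp, List.suffix_rfl, by simp⟩
    exact_mod_cast h2.trans h1
  refine ⟨?_, hone⟩
  by_contra! hΔ
  obtain ⟨k, hk⟩ := exists_nat_ge (a * Real.log n)
  rcases le_or_gt Δ 0 with h0 | h0
  · have h1 := hone (2 * k + 1) (hk.trans (by push_cast; linarith [k.cast_nonneg (α := ℝ)]))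
    have h2 : Δ ^ (2 * k + 1) ≤ 0 := Odd.pow_nonpos ⟨k, rfl⟩ h0
    nlinarith
  · obtain ⟨j, hj⟩ := exists_pow_lt_of_lt_one (inv_pos.2 hc) hΔ
    have h1 := hone (k + j) (hk.trans (by push_cast; linarith [j.cast_nonneg (α := ℝ)]))
    have h2 : Δ ^ (k + j) ≤ Δ ^ j := pow_le_pow_of_le_one h0.le hΔ.le (Nat.le_add_left _ _)
    have h3 : c * Δ ^ (k + j) < c * c⁻¹ := mul_lt_mul_of_pos_left (h2.trans_lt hj) hc
    rw [mul_inv_cancel₀ hc.ne'] at h3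
    linarith

theorem mainTheorem11 :
    ∃ (P : RAM.Cmd) (K : ℝ),
      ∀ (𝒢 : Set FinGraph) (Δ a c : ℝ), ConnectiveConstantAtMost 𝒢 Δ a c →
        ∃ C : ℝ, ∀ (n : ℕ) (G : SimpleGraph (Fin n)), 0 < n → (⟨n, G⟩ : FinGraph) ∈ 𝒢 →
          ∀ (p : Fin n → ℂ) (α ε : ℝ), 0 < α → α ≤ 1 → 0 < ε → ε ≤ 1 / (n : ℝ) →
            (fun v => (1 + (α : ℂ)) ^ 2 * p v) ∈ shearerRegion G →
            ∀ ℓ : ℝ, ℓ = max (a * Real.log n) (4 / √α * Real.log (n / (ε * α))) →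
              ∀ (adj : Fin n → List (Fin n)), IsAdjLists G adj →
                ∀ s : RAM.Memory, IsInput n adj p ⌈ℓ⌉₊ s →
                  ∃ (t : ℕ) (s₁ : RAM.Memory), RAM.Exec P s t s₁ ∧
                    (t : ℝ) ≤ C * (n * Δ ^ ℓ) ∧
                    ‖output s₁ - altIndepPoly G Finset.univ p‖ ≤
                      K * (ε * n) * ‖altIndepPoly G Finset.univ p‖ := by
  -- With `B = c * Δ ^ ⌈ℓ⌉₊ ≥ 1` the time is at most `154 (2n + 1 + 7nB) + 20 ≤ 1560 nB`; the factor
  -- `Δ` pays for rounding `ℓ` up.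
  refine ⟨ratioProgram, 2, fun 𝒢 Δ a c hconn => ⟨2000 * c * Δ, ?_⟩⟩
  intro n G hn hG p α ε hα hα1 hε hεn hp ℓ hℓ adj hadj s hs
  have hadj' : ∀ v w, w ∈ adj v ↔ G.Adj v w := fun v => (hadj v).2
  obtain ⟨t, s₁, hexec, ht, hout⟩ := exec_ratioProgram hn
    (fun D M v hv => (ratio_estimates G p α hα hα1 hp adj hadj' D M v hv).1) hs
  refine ⟨t, s₁, hexec, ?_, ?_⟩
  · obtain ⟨hΔ, hone⟩ := one_le_of_connectiveConstantAtMost hconn hn hG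
    obtain ⟨ha, hc, hconn⟩ := hconn
    have hn1 : (1 : ℝ) ≤ n := by exact_mod_cast hn
    have hlogn : 0 ≤ a * Real.log n := mul_nonneg ha.le (Real.log_nonneg hn1)
    have hℓa : a * Real.log n ≤ ℓ := hℓ ▸ le_max_left _ _
    have hL : a * Real.log n ≤ ⌈ℓ⌉₊ := hℓa.trans (Nat.le_ceil ℓ)
    have hB := hone _ hL
    have hpow : Δ ^ ⌈ℓ⌉₊ ≤ Δ * Δ ^ ℓ := by
      rw [← Real.rpow_natCast, mul_comm, ← Real.rpow_add_one (by linarith)]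
      exact Real.rpow_le_rpow_of_exponent_le hΔ (Nat.ceil_lt_add_one (hlogn.trans hℓa)).le
    have hsum : ((((kids ∅ (List.finRange n)).map
        (fun c => nodeSteps adj ⌈ℓ⌉₊ c.1 c.2)).sum : ℕ) : ℝ) ≤ n * (7 * (c * Δ ^ ⌈ℓ⌉₊)) := by
      have h1 : ∀ x ∈ ((kids ∅ (List.finRange n)).map
          (fun c => (nodeSteps adj ⌈ℓ⌉₊ c.1 c.2 : ℝ))), x ≤ 7 * (c * Δ ^ ⌈ℓ⌉₊) := by
        intro x hx
        obtain ⟨d, hd, rfl⟩ := List.mem_map.1 hx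
        have h2 := nodeSteps_le G adj hadj' (fun v => (hadj v).1) ⌈ℓ⌉₊ d.1 d.2
          (snd_mem_fst_of_mem_kids hd).1
        have h3 := hconn n G hG d.2 _ hL
        have h4 : (nodeSteps adj ⌈ℓ⌉₊ d.1 d.2 : ℝ) ≤
            7 * ∑ i ∈ range (⌈ℓ⌉₊ + 1), (sawCount G d.2 i : ℝ) := by
          exact_mod_cast h2
        linarith
      have h2 := List.sum_le_card_nsmul _ _ h1
      rw [List.length_map, nsmul_eq_mul] at h2
      have h3 : ((kids ∅ (List.finRange n)).length : ℝ) ≤ n := by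
        exact_mod_cast (length_kids_le (List.finRange n) ∅).trans_eq (List.length_finRange)
      have h4 : (0 : ℝ) ≤ 7 * (c * Δ ^ ⌈ℓ⌉₊) := by linarith
      rw [Nat.cast_list_sum, List.map_map]
      exact h2.trans (mul_le_mul_of_nonneg_right h3 h4)
    have ht' : (t : ℝ) ≤ 154 * (2 * n + 1 + (((kids ∅ (List.finRange n)).map
        (fun c => nodeSteps adj ⌈ℓ⌉₊ c.1 c.2)).sum : ℕ)) + 20 := by exact_mod_cast ht
    have hnB : (n : ℝ) ≤ n * (c * Δ ^ ⌈ℓ⌉₊) := le_mul_of_one_le_right (by linarith) hB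
    calc (t : ℝ) ≤ 2000 * (n * (c * Δ ^ ⌈ℓ⌉₊)) := by linarith
      _ ≤ 2000 * (n * (c * (Δ * Δ ^ ℓ))) := by gcongr
      _ = _ := by ring
  · rw [hout]
    exact norm_prod_ratio_sub_altIndepPoly_le hn G p α ε ℓ hα hα1 hε hεn hp
      (hℓ ▸ le_max_right _ _) adj hadj'
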